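/- Let $n\ge 2$. A convex body in $\mathbb R^n$ is a compact convex set with non-empty interior; $|\cdot|$ denotes volume (Lebesgue measure of the appropriate dimension), $B_2^k$ the Euclidean unit ball of $\mathbb R^k$, $K|\xi^\perp$ the orthogonal projection of $K$ to the hyperplane $\xi^\perp=\{x:\langle x,\xi\rangle=0\}$, and $S(\cdot)$ the surface area: for a convex body $M$ in a $d$-dimensional Euclidean space, $S(M)$ is the $(d-1)$-dimensional Hausdorff measure of its boundary (so $S(L)$ is taken in $\mathbb R^n$, and $S(L|\xi^\perp)$ in the $(n-1)$-dimensional space $\xi^\perp$; for $d=1$ it is the number of boundary points). A convex body $L$ in $\mathbb R^n$ is called a projection body if it is origin-symmetric and there is a convex body $K$ in $\mathbb R^n$ such that the support function $h_L(\theta)=\max_{y\in L}\langle\theta,y\rangle$ satisfies $h_L(\theta)=|K|\theta^\perp|$ for every $\theta\in S^{n-1}$. Put $$c_n=\frac{|B_2^n|^{\frac{n-1}{n}}}{|B_2^{n-1}|}.$$ If $L$ is a projection body in $\mathbb R^n$, then $\min_{\xi\in S^{n-1}}S(L|\xi^\perp)$ is attained and $$S(L)\ \ge\ \frac{n}{n-1}\,c_n\,\min_{\xi\in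 S^{n-1}}S(L|\xi^\perp)\;|L|^{1/n}.$$ Moreover $c_n>1/\sqrt e$, and the inequality is sharp: $B_2^n$ is a projection body and equality holds for $L=B_2^n$. -/

import Mathlib

open MeasureTheory

noncomputable section

/-- The central hyperplane `ξ^⊥`, as a Euclidean space in its own right. -/
abbrev perpHyperplane {n : ℕ} (ξ : EuclideanSpace ℝ (Fin n)) :
    Submodule ℝ (EuclideanSpace ℝ (Fin n)) :=
  (Submodule.span ℝ {ξ})ᗮ

/-- The orthogonal projection `K | ξ^⊥`, as a subset of the hyperplane `ξ^⊥`. -/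
def hyperplaneProjection {n : ℕ} (K : Set (EuclideanSpace ℝ (Fin n)))
    (ξ : EuclideanSpace ℝ (Fin n)) : Set (perpHyperplane ξ) :=
  (perpHyperplane ξ).orthogonalProjectionOnto '' K

/-- The surface area of a convex body `K` in a Euclidean space `E` of dimension `d`: the
`(d-1)`-dimensional measure of the boundary of `K`. Here `μHE[k]` is the `k`-dimensional Hausdorff
measure, normalized to agree with Lebesgue measure in dimension `k`. -/
def surfaceArea {E : Type*} [NormedAddCommGroup E] [InnerProductSpace ℝ E] [MeasurableSpace E]
    [BorelSpace E] (K : Set E) : ℝ :=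
  (μHE[Module.finrank ℝ E - 1] : Measure E).real (frontier K)

/-- The support function `h_K(x) = max {⟨x, y⟩ : y ∈ K}`. -/
def supportFunction {E : Type*} [NormedAddCommGroup E] [InnerProductSpace ℝ E]
    (K : Set E) (x : E) : ℝ :=
  sSup ((fun y : E => inner ℝ x y) '' K)

/-- `L` is the projection body `ΠK` of `K`: it is origin-symmetric, and its value of the support
function in every direction `θ` is the volume of the projection of `K` to `θ^⊥`. -/
def IsProjectionBodyOf {n : ℕ} (L K : ConvexBody (EuclideanSpace ℝ (Fin n))) : Prop :=
  (∀ x ∈ L, -x ∈ L) ∧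
    ∀ θ : EuclideanSpace ℝ (Fin n), ‖θ‖ = 1 →
      supportFunction (L : Set (EuclideanSpace ℝ (Fin n))) θ =
        volume.real (hyperplaneProjection (K : Set (EuclideanSpace ℝ (Fin n))) θ)

/-- `L` is a projection body: a convex body with non-empty interior that is the projection body of
some convex body with non-empty interior. (`ConvexBody` alone does not ask for interior points.) -/
def IsProjectionBody {n : ℕ} (L : ConvexBody (EuclideanSpace ℝ (Fin n))) : Prop :=
  (interior (L : Set (EuclideanSpace ℝ (Fin n)))).Nonempty ∧
    ∃ K : ConvexBody (EuclideanSpace ℝ (Fin n)),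
      (interior (K : Set (EuclideanSpace ℝ (Fin n)))).Nonempty ∧ IsProjectionBodyOf L K

/-- The Euclidean unit ball `B_2^n`. -/
def unitBall (n : ℕ) : ConvexBody (EuclideanSpace ℝ (Fin n)) where
  carrier := Metric.closedBall 0 1
  convex' := convex_closedBall 0 1
  isCompact' := isCompact_closedBall 0 1
  nonempty' := Metric.nonempty_closedBall.2 zero_le_one

/-- Volume of a convex body in `ℝ^n`. -/
def bodyVolume {n : ℕ} (K : ConvexBody (EuclideanSpace ℝ (Fin n))) : ℝ :=
  volume.real (K : Set (EuclideanSpace ℝ (Fin n)))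

/-- `c_n = |B_2^n|^((n-1)/n) / |B_2^{n-1}|`, for `n ≥ 1`. -/
def ballConstant (n : ℕ) : ℝ :=
  bodyVolume (unitBall n) ^ (((n : ℝ) - 1) / n) / bodyVolume (unitBall (n - 1))

/-- `m = min_{ξ ∈ S^{n-1}} S(L | ξ^⊥)`; in particular the minimum is attained. -/
def IsMinProjectionSurfaceArea {n : ℕ} (L : ConvexBody (EuclideanSpace ℝ (Fin n))) (m : ℝ) : Prop :=
  IsLeast {s : ℝ | ∃ ξ : EuclideanSpace ℝ (Fin n), ‖ξ‖ = 1 ∧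
    s = surfaceArea (hyperplaneProjection (L : Set (EuclideanSpace ℝ (Fin n))) ξ)} m

end

noncomputable section ConvexBodyInequality

set_option linter.unusedSectionVars false

open Metric Set Module Filter Topology
open scoped Pointwise ENNReal NNReal

/-! Write `sweep A a` for the volume gained when `A` is swept along `[0, a]`; it equals `‖a‖` times
the volume of the projection of `A` to `a^⊥`. For a convex body `K` it is therefore the support
function of the projection body of `K`, extended homogeneously. For a polytope it is exactly the
support function of a zonotope whose generators are the facet normals scaled by the facet areas, so
every projection body `L` lies between a zonotope `Z` and a dilate of it as close to 1 as desired.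
It is enough to treat `Z`, with generators `a`, and two inequalities do so.

(1) `m * Σ ‖a‖ ≤ (n - 1) * S(Z)`, where `m` bounds all `S(Z|ξ^⊥)` from below
(`mul_sum_norm_le_surfaceArea`). The second difference of volume along `a` and `c` is `‖a‖` times
the sweep of `Z|a^⊥` along the projection of `c`. Summed over the generators `a`, Euler's relation
for the function `sweep · c`, homogeneous of degree `n - 1`, bounds it by `(n - 1) * sweep Z c`.
Summed over generators `c` of a zonotope close to the unit ball, Cauchy's formula turns the sweeps
into surface areas, in the space and in all hyperplanes at once.

(2) `n * c_n * |Z|^(1/n) ≤ Σ ‖a‖` (`ballConstant_mul_volume_rpow_le_sum_norm`). This is Minkowski's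
first inequality for a ball and `Z`, since the mixed volume of a ball with a segment depends only on
the length of the segment. It follows from Brunn–Minkowski, which is derived here from
Prékopa–Leindler.

Mixed volumes are never defined: their derivatives are replaced by adding the segments of a zonotope
one at a time, with monotone increments (`telescope_zonotope`), and every approximation carries a
factor that tends to 1. For the ball all projections are balls, which gives equality. The bound on
`c_n` comes from estimates of `log Γ`. -/

theorem isCompact_segment {V : Type*} [NormedAddCommGroup V] [NormedSpace ℝ V] (a b : V) :
    IsCompact (segment ℝ a b) := by
  rw [segment_eq_image_lineMap]
  exact isCompact_Icc.image (by fun_prop)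

theorem mem_segment_zero {V : Type*} [NormedAddCommGroup V] [NormedSpace ℝ V] {a x : V} :
    x ∈ segment ℝ 0 a ↔ ∃ t ∈ Icc (0 : ℝ) 1, t • a = x := by
  rw [segment_eq_image_lineMap]
  simp [AffineMap.lineMap_apply]

/-! ### Sweeping a convex set along a segment. -/

section Sweep

variable {E : Type*} [NormedAddCommGroup E] [InnerProductSpace ℝ E]
  [FiniteDimensional ℝ E] [MeasurableSpace E] [BorelSpace E]

/-- The orthogonal projection to the hyperplane `a^⊥`. -/
abbrev perpProj (a : E) : E →L[ℝ] (Submodule.span ℝ {a})ᗮ :=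
  (Submodule.span ℝ {a})ᗮ.orthogonalProjectionOnto

/-- Fubini along the lines parallel to `a`; the parameter `t` runs at speed `‖a‖`, whence the
factor. -/
theorem volume_eq_lintegral_perp {a : E} (ha : a ≠ 0) {T : Set E} (hT : MeasurableSet T) :
    volume T = ‖a‖ₑ * ∫⁻ y : (Submodule.span ℝ {a})ᗮ, volume {t : ℝ | (y : E) + t • a ∈ T} := by
  have h := (Submodule.span ℝ {a}).measurePreserving_measurableEquivProd (0 : E)
  rw [InnerProductSpace.euclideanHausdorffMeasure_eq_volume] at h
  rw [← h.symm.measure_preimage_equiv, Measure.volume_eq_prod,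
    Measure.prod_apply_symm (MeasurableEquiv.measurable _ hT),
    ← lintegral_const_mul' _ _ enorm_ne_top]
  congr with y
  set v : Submodule.span ℝ {a} := ⟨a, Submodule.mem_span_singleton_self a⟩ with hv
  have hv0 : v ≠ 0 := by simpa [hv] using ha
  have hm : Measurable fun t : ℝ => t • v := by fun_prop
  rw [volume_eq_of_finrank_eq_one (finrank_span_singleton ha) hv0, Measure.smul_apply,
    Measure.map_apply hm]
  · have : ‖v‖ₑ = ‖a‖ₑ := rfl
    rw [this, smul_eq_mul]
    congr 2
    ext t
    simp [hv, add_comm]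
  · exact (measurable_prodMk_right (MeasurableEquiv.measurable _ hT))

theorem perpProj_add_smul (a : E) (y : (Submodule.span ℝ {a})ᗮ) (t : ℝ) :
    perpProj a ((y : E) + t • a) = y := by
  rw [map_add, map_smul, Submodule.orthogonalProjectionOnto_mem_subspace_eq_self,
    Submodule.orthogonalProjectionOnto_orthogonalComplement_singleton_eq_zero]
  simp

theorem exists_eq_perpProj_add_smul (a x : E) : ∃ t : ℝ, x = (perpProj a x : E) + t • a := by
  have h := (Submodule.span ℝ {a}).starProjection_add_starProjection_orthogonal x
  obtain ⟨t, ht⟩ := Submodule.mem_span_singleton.1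
    (Submodule.starProjection_apply_mem (Submodule.span ℝ {a}) x)
  refine ⟨t, ?_⟩
  rw [ht, add_comm]
  exact h.symm

theorem mem_perpProj_image_iff {a : E} {A : Set E} {y : (Submodule.span ℝ {a})ᗮ} :
    y ∈ perpProj a '' A ↔ ∃ t : ℝ, (y : E) + t • a ∈ A := by
  constructor
  · rintro ⟨x, hx, rfl⟩
    obtain ⟨t, ht⟩ := exists_eq_perpProj_add_smul a x
    exact ⟨t, ht ▸ hx⟩
  · rintro ⟨t, ht⟩
    exact ⟨_, ht, perpProj_add_smul a y t⟩

theorem Real.volume_add_Icc {I : Set ℝ} (hc : IsCompact I) (hI : Convex ℝ I) (hne : I.Nonempty) :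
    volume (I + Icc (0 : ℝ) 1) = volume I + 1 := by
  have h : I = Icc (sInf I) (sSup I) :=
    eq_Icc_of_connected_compact ⟨hne, hI.isPreconnected⟩ hc
  have hle : sInf I ≤ sSup I := csInf_le_csSup hne hc.bddBelow hc.bddAbove
  rw [h, Set.Icc_add_Icc hle zero_le_one, Real.volume_Icc, Real.volume_Icc,
    ← ENNReal.ofReal_one, ← ENNReal.ofReal_add (by linarith) zero_le_one]
  ring_nf

/-- On each line parallel to `a` that meets `A`, the set of parameters is a compact interval and
grows by exactly 1; the other fibres stay empty. -/
theorem volume_add_segment {A : Set E} (hc : IsCompact A) (hA : Convex ℝ A) {a : E} (ha : a ≠ 0) :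
    volume (A + segment ℝ 0 a) = volume A + ‖a‖ₑ * volume (perpProj a '' A) := by
  have hc' := hc.add (isCompact_segment 0 a)
  rw [volume_eq_lintegral_perp ha hc'.measurableSet, volume_eq_lintegral_perp ha hc.measurableSet,
    ← mul_add]
  have hm : MeasurableSet (perpProj a '' A) := (hc.image (perpProj a).continuous).measurableSet
  rw [← lintegral_indicator_one hm, ← lintegral_add_right _ (measurable_one.indicator hm)]
  congr with y
  have hs : {t : ℝ | (y : E) + t • a ∈ A + segment ℝ 0 a} =
      {t : ℝ | (y : E) + t • a ∈ A} + Icc (0 : ℝ) 1 := by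
    ext t
    simp only [mem_ofPred_eq, Set.mem_add, mem_segment_zero]
    constructor
    · rintro ⟨x, hx, _, ⟨s, hs, rfl⟩, h⟩
      refine ⟨t - s, ?_, s, hs, by ring⟩
      rw [sub_smul, ← add_sub_assoc, ← h, add_sub_cancel_right]
      exact hx
    · rintro ⟨r, hr, s, hs, rfl⟩
      exact ⟨_, hr, _, ⟨s, hs, rfl⟩, by rw [add_smul, add_assoc]⟩
  rw [hs]
  by_cases hy : y ∈ perpProj a '' A
  · rw [indicator_of_mem hy, Pi.one_apply]
    apply Real.volume_add_Icc
    · have hemb : IsClosedEmbedding fun t : ℝ => (y : E) + t • a :=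
        (Homeomorph.addLeft (y : E)).isClosedEmbedding.comp
          (isClosedEmbedding_smul_left ha)
      exact hemb.isCompact_preimage hc
    · have h : {t : ℝ | (y : E) + t • a ∈ A} = AffineMap.lineMap (y : E) ((y : E) + a) ⁻¹' A := by
        ext t
        simp [AffineMap.lineMap_apply, add_comm]
      rw [h]
      exact hA.affine_preimage _
    · exact mem_perpProj_image_iff.1 hy
  · rw [indicator_of_notMem hy]
    have : {t : ℝ | (y : E) + t • a ∈ A} = ∅ := by
      ext t
      simp only [mem_ofPred_eq, mem_empty_iff_false, iff_false]
      exact fun h => hy (mem_perpProj_image_iff.2 ⟨t, h⟩)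
    simp [this]

/-- The volume gained by sweeping `A` along the segment `[0, a]`. -/
def sweep (A : Set E) (a : E) : ℝ := volume.real (A + segment ℝ 0 a) - volume.real A

/-- The volume of the projection of `A` to the subspace `W`. -/
def projVolume (W : Submodule ℝ E) (A : Set E) : ℝ :=
  volume.real (W.orthogonalProjectionOnto '' A)

theorem sweep_zero (A : Set E) : sweep A 0 = 0 := by simp [sweep]

theorem sweep_eq {A : Set E} (hc : IsCompact A) (hA : Convex ℝ A) (a : E) :
    sweep A a = ‖a‖ * projVolume (Submodule.span ℝ {a})ᗮ A := by
  rcases eq_or_ne a 0 with rfl | ha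
  · simp [sweep]
  · have hfin : volume (perpProj a '' A) ≠ ⊤ :=
      (hc.image (perpProj a).continuous).measure_lt_top.ne
    rw [sweep, measureReal_def, measureReal_def, volume_add_segment hc hA ha,
      ENNReal.toReal_add hc.measure_lt_top.ne (ENNReal.mul_ne_top enorm_ne_top hfin),
      ENNReal.toReal_mul, toReal_enorm]
    simp [projVolume, measureReal_def]

theorem sweep_nonneg {A : Set E} (hc : IsCompact A) (hA : Convex ℝ A) (a : E) :
    0 ≤ sweep A a := by
  rw [sweep_eq hc hA]
  exact mul_nonneg (norm_nonneg _) measureReal_nonneg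

theorem projVolume_mono (W : Submodule ℝ E) {A B : Set E} (hB : IsCompact B) (h : A ⊆ B) :
    projVolume W A ≤ projVolume W B :=
  measureReal_mono (image_mono h)
    (hB.image W.orthogonalProjectionOnto.continuous).measure_lt_top.ne

/-- The source of all later monotonicity: the increment of volume is a projected volume up to the
factor `‖a‖`, so it grows with the body. -/
theorem sweep_mono {A B : Set E} (hcA : IsCompact A) (hA : Convex ℝ A) (hcB : IsCompact B)
    (hB : Convex ℝ B) (h : A ⊆ B) (a : E) : sweep A a ≤ sweep B a := by
  rw [sweep_eq hcA hA, sweep_eq hcB hB]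
  exact mul_le_mul_of_nonneg_left (projVolume_mono _ hcB h) (norm_nonneg _)

theorem sweep_smul_right {A : Set E} (hc : IsCompact A) (hA : Convex ℝ A) {s : ℝ} (hs : 0 ≤ s)
    (a : E) : sweep A (s • a) = s * sweep A a := by
  rcases hs.eq_or_lt with rfl | hs
  · simp [sweep_zero]
  · rw [sweep_eq hc hA, sweep_eq hc hA, Submodule.span_singleton_smul_eq hs.ne'.isUnit, norm_smul,
      Real.norm_of_nonneg hs.le, mul_assoc]

theorem volume_real_smul {r : ℝ} (hr : 0 ≤ r) (A : Set E) :
    volume.real (r • A) = r ^ finrank ℝ E * volume.real A := by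
  rw [measureReal_def, Measure.addHaar_smul, ENNReal.toReal_mul, measureReal_def,
    ENNReal.toReal_ofReal (abs_nonneg _), abs_of_nonneg (by positivity)]

/-- Scaling body and segment together gives `r ^ d`; one factor `r` belongs to the segment. -/
theorem sweep_smul_left [Nontrivial E] {A : Set E} (hc : IsCompact A) (hA : Convex ℝ A)
    {r : ℝ} (hr : 0 < r) (a : E) :
    sweep (r • A) a = r ^ (finrank ℝ E - 1) * sweep A a := by
  have h1 : sweep (r • A) (r • a) = r ^ finrank ℝ E * sweep A a := by
    have : r • A + segment ℝ 0 (r • a) = r • (A + segment ℝ 0 a) := by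
      rw [smul_add]
      congr 1
      ext x
      simp only [mem_segment_zero, Set.mem_smul_set]
      constructor
      · rintro ⟨t, ht, rfl⟩
        exact ⟨t • a, ⟨t, ht, rfl⟩, smul_comm _ _ _⟩
      · rintro ⟨_, ⟨t, ht, rfl⟩, rfl⟩
        exact ⟨t, ht, smul_comm _ _ _⟩
    rw [sweep, this, volume_real_smul hr.le, volume_real_smul hr.le, sweep]
    ring
  rw [sweep_smul_right (hc.smul r) (hA.smul r) hr.le] at h1
  have h2 : finrank ℝ E = finrank ℝ E - 1 + 1 := (Nat.sub_add_cancel finrank_pos).symm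
  rw [h2, pow_succ] at h1
  have : r * sweep (r • A) a = r * (r ^ (finrank ℝ E - 1) * sweep A a) := by
    rw [h1]; ring
  exact mul_left_cancel₀ hr.ne' this

theorem sweep_vadd (A : Set E) (v a : E) : sweep (v +ᵥ A) a = sweep A a := by
  have h : (v +ᵥ A) + segment ℝ 0 a = v +ᵥ (A + segment ℝ 0 a) := by
    rw [← Set.singleton_vadd, ← Set.singleton_vadd, vadd_eq_add, vadd_eq_add, add_assoc]
  rw [sweep, sweep, h, measureReal_def, measureReal_def, measure_vadd, measure_vadd]
  rfl

theorem image_segment_zero {F : Type*} [AddCommGroup F] [Module ℝ F] (f : E →ₗ[ℝ] F) (a : E) :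
    f '' segment ℝ 0 a = segment ℝ 0 (f a) := by
  rw [← LinearMap.coe_toAffineMap, image_segment]
  simp

/-- The increment of `sweep · c` under sweeping along `[0, a]`. -/
theorem sweep_add_segment_sub {A : Set E} (hc : IsCompact A) (hA : Convex ℝ A) (a c : E) :
    sweep (A + segment ℝ 0 a) c - sweep A c =
      ‖a‖ * sweep (perpProj a '' A) (perpProj a c) := by
  -- The second difference of volume is symmetric in `a` and `c`; after the exchange both terms are
  -- projected volumes on the same hyperplane `a^⊥`.
  have h1 : sweep (A + segment ℝ 0 a) c - sweep A c =
      sweep (A + segment ℝ 0 c) a - sweep A a := by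
    simp only [sweep, add_right_comm A]
    ring
  rw [h1, sweep_eq (hc.add (isCompact_segment 0 c)) (hA.add (convex_segment _ _)),
    sweep_eq hc hA, ← mul_sub]
  congr 1
  simp only [projVolume, sweep]
  have h3 : perpProj a '' (A + segment ℝ 0 c) =
      perpProj a '' A + segment ℝ 0 (perpProj a c) := by
    rw [Set.image_add]
    congr 1
    exact image_segment_zero (perpProj a).toLinearMap c
  rw [h3]

end Sweep

/-! ### Volume increments and surface area of polytopes. -/

section Polytope

variable {E : Type*} [NormedAddCommGroup E] [InnerProductSpace ℝ E]
  [FiniteDimensional ℝ E] [MeasurableSpace E] [BorelSpace E]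

theorem volume_hyperplane {w : E} (hw : w ≠ 0) (k : ℝ) :
    volume {x : E | inner ℝ w x = k} = 0 := by
  have hm : MeasurableSet {x : E | inner ℝ w x = k} :=
    (isClosed_eq (by fun_prop) continuous_const).measurableSet
  rw [volume_eq_lintegral_perp hw hm]
  have h : ∀ y : (Submodule.span ℝ {w})ᗮ,
      volume {t : ℝ | (y : E) + t • w ∈ {x : E | inner ℝ w x = k}} = 0 := by
    intro y
    refine (Set.Subsingleton.measure_zero ?_ _)
    intro s hs t ht
    simp only [mem_ofPred_eq, inner_add_right, inner_smul_right] at hs ht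
    have : inner ℝ w w ≠ (0 : ℝ) := inner_self_ne_zero.2 hw
    apply mul_right_cancel₀ this
    linarith
  simp_rw [h, lintegral_zero, mul_zero]

/-- Prisms over a set in a hyperplane: the volume is base area times height. -/
theorem volume_prism {F : Set E} {u : E} {h : ℝ} (hF : ∀ x ∈ F, inner ℝ u x = h)
    (hu : ‖u‖ = 1) {a : E} (ha : 0 ≤ inner ℝ u a) :
    volume (F + segment ℝ 0 a) = ENNReal.ofReal (inner ℝ u a) * volume (F + segment ℝ 0 u) := by
  -- This map sends `u` to `a` and acts on the hyperplane of `F` as a translation, so it carries one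
  -- prism onto a translate of the other; its determinant is `⟨u, a⟩`.
  set M := LinearMap.transvection (innerₛₗ ℝ u) (a - u) with hM
  have huu : inner ℝ u u = (1 : ℝ) := by rw [real_inner_self_eq_norm_sq, hu]; norm_num
  have hdet : LinearMap.det M = inner ℝ u a := by
    rw [hM, LinearMap.transvection.det]
    simp only [innerₛₗ_apply_apply, inner_sub_right, huu]
    ring
  have himg : M '' (F + segment ℝ 0 u) = (h • (a - u)) +ᵥ (F + segment ℝ 0 a) := by
    have hMx : ∀ x ∈ F, ∀ s : ℝ, M (x + s • u) = h • (a - u) + (x + s • a) := by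
      intro x hx s
      simp only [hM, LinearMap.transvection.apply, innerₛₗ_apply_apply, inner_add_right, hF x hx,
        inner_smul_right, huu]
      module
    ext z
    simp only [Set.mem_image, Set.mem_add, mem_segment_zero, Set.mem_vadd_set, vadd_eq_add]
    constructor
    · rintro ⟨_, ⟨x, hx, _, ⟨s, hs, rfl⟩, rfl⟩, rfl⟩
      exact ⟨_, ⟨x, hx, _, ⟨s, hs, rfl⟩, rfl⟩, (hMx x hx s).symm⟩
    · rintro ⟨_, ⟨x, hx, _, ⟨s, hs, rfl⟩, rfl⟩, rfl⟩
      exact ⟨_, ⟨x, hx, _, ⟨s, hs, rfl⟩, rfl⟩, hMx x hx s⟩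
  have h1 := Measure.addHaar_image_linearMap volume M (F + segment ℝ 0 u)
  rw [himg, measure_vadd, hdet, abs_of_nonneg ha] at h1
  exact h1

/-- Two transversal hyperplanes meet in codimension two, and sweeping along `u` stays in one
hyperplane, normal to the component `w` of `v` orthogonal to `u`. Opposite normals are excluded
because the two hyperplanes could then coincide. -/
theorem volume_prism_inter_eq_zero {G : Set E} {u v : E} {h k : ℝ}
    (hu : ‖u‖ = 1) (hv : ‖v‖ = 1) (hne : (u, h) ≠ (v, k)) (hneg : u ≠ -v)
    (hG : ∀ x ∈ G, inner ℝ u x = h ∧ inner ℝ v x = k) :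
    volume (G + segment ℝ 0 u) = 0 := by
  have huu : inner ℝ u u = (1 : ℝ) := by rw [real_inner_self_eq_norm_sq, hu]; norm_num
  rcases eq_or_ne u v with rfl | huv
  · have : G = ∅ := by
      ext x
      simp only [mem_empty_iff_false, iff_false]
      intro hx
      exact hne (by rw [← (hG x hx).1, ← (hG x hx).2])
    simp [this]
  · set w := v - inner ℝ u v • u with hw
    have hw0 : w ≠ 0 := by
      intro h0
      have h1 : v = (inner ℝ u v : ℝ) • u := sub_eq_zero.1 h0
      have h2 : |(inner ℝ u v : ℝ)| = 1 := by
        have := congrArg norm h1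
        rw [norm_smul, hu, hv, mul_one, Real.norm_eq_abs] at this
        exact this.symm
      rcases (abs_eq zero_le_one).1 h2 with h3 | h3
      · rw [h3, one_smul] at h1; exact huv h1.symm
      · rw [h3, neg_smul, one_smul] at h1; exact hneg (by rw [h1, neg_neg])
    refine measure_mono_null ?_ (volume_hyperplane hw0 (k - inner ℝ u v * h))
    rintro _ ⟨x, hx, _, hs, rfl⟩
    obtain ⟨s, -, rfl⟩ := mem_segment_zero.1 hs
    simp only [mem_ofPred_eq, hw, inner_sub_left, inner_add_right, inner_smul_left,
      inner_smul_right, (hG x hx).1, (hG x hx).2, huu, real_inner_comm u v, conj_trivial]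
    ring

/-- The intersection of the half-spaces `{x | ⟨u, x⟩ ≤ h}` with `(u, h) ∈ s`. -/
def polytope (s : Finset (E × ℝ)) : Set E := {x | ∀ p ∈ s, inner ℝ p.1 x ≤ p.2}

/-- The face of `polytope s` in the hyperplane `p`. -/
def facet (s : Finset (E × ℝ)) (p : E × ℝ) : Set E := polytope s ∩ {x | inner ℝ p.1 x = p.2}

/-- The `(d - 1)`-dimensional volume of a facet, as the volume of the prism of height one. -/
def facetArea (s : Finset (E × ℝ)) (p : E × ℝ) : ℝ := volume.real (facet s p + segment ℝ 0 p.1)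

theorem facetArea_nonneg (s : Finset (E × ℝ)) (p : E × ℝ) : 0 ≤ facetArea s p :=
  measureReal_nonneg

theorem isClosed_polytope (s : Finset (E × ℝ)) : IsClosed (polytope s) := by
  have : polytope s = ⋂ p ∈ s, {x | inner ℝ p.1 x ≤ p.2} := by ext; simp [polytope]
  rw [this]
  exact isClosed_biInter fun p _ => isClosed_le (by fun_prop) continuous_const

theorem convex_polytope (s : Finset (E × ℝ)) : Convex ℝ (polytope s) := by
  have : polytope s = ⋂ p ∈ s, {x | innerₛₗ ℝ p.1 x ≤ p.2} := by ext; simp [polytope]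
  rw [this]
  exact convex_iInter₂ fun p _ => convex_halfSpace_le (innerₛₗ ℝ p.1).isLinear _

theorem facet_subset (s : Finset (E × ℝ)) (p : E × ℝ) : facet s p ⊆ polytope s := inter_subset_left

theorem isCompact_facet {s : Finset (E × ℝ)} (hs : IsCompact (polytope s)) (p : E × ℝ) :
    IsCompact (facet s p) :=
  hs.inter_right (isClosed_eq (by fun_prop) continuous_const)

theorem convex_facet (s : Finset (E × ℝ)) (p : E × ℝ) : Convex ℝ (facet s p) :=
  (convex_polytope s).inter (convex_hyperplane (innerₛₗ ℝ p.1).isLinear p.2)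

/-- A point moving in direction `a` leaves the polytope through a facet that faces `a`, so the added
region consists of prisms over these facets. -/
theorem polytope_add_segment (s : Finset (E × ℝ)) (a : E) :
    polytope s + segment ℝ 0 a = polytope s ∪
      ⋃ p ∈ s.filter (fun p => 0 < (inner ℝ p.1 a : ℝ)), (facet s p + segment ℝ 0 a) := by
  apply Subset.antisymm
  · rintro _ ⟨y, hy, _, hseg, rfl⟩
    obtain ⟨t, ht, rfl⟩ := mem_segment_zero.1 hseg
    by_cases hx : y + t • a ∈ polytope s
    · exact Or.inl hx
    right
    -- `r p` is the time at which the ray from `y` reaches the hyperplane `p`; its minimum over the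
    -- violated constraints is the exit time.
    set r : E × ℝ → ℝ := fun p => (p.2 - inner ℝ p.1 y) / inner ℝ p.1 a
    have hne : (s.filter fun p => p.2 < (inner ℝ p.1 (y + t • a) : ℝ)).Nonempty := by
      simp only [polytope, mem_ofPred_eq, not_forall, not_le] at hx
      obtain ⟨p, hp, h⟩ := hx
      exact ⟨p, Finset.mem_filter.2 ⟨hp, h⟩⟩
    have key : ∀ q ∈ s.filter (fun p => p.2 < (inner ℝ p.1 (y + t • a) : ℝ)),
        0 < (inner ℝ q.1 a : ℝ) ∧ 0 ≤ r q ∧ r q ≤ t := by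
      intro q hq
      obtain ⟨hq, h⟩ := Finset.mem_filter.1 hq
      have h1 := hy q hq
      rw [inner_add_right, inner_smul_right] at h
      have h2 : 0 < (inner ℝ q.1 a : ℝ) := by
        by_contra hn
        have := mul_nonpos_of_nonneg_of_nonpos ht.1 (not_lt.1 hn)
        linarith
      exact ⟨h2, div_nonneg (by linarith) h2.le, (div_le_iff₀ h2).2 (by linarith)⟩
    obtain ⟨p, hp, hmin⟩ := Finset.exists_min_image _ r hne
    obtain ⟨h2, h0, h3⟩ := key p hp
    have hps := (Finset.mem_filter.1 hp).1
    refine mem_iUnion₂.2 ⟨p, Finset.mem_filter.2 ⟨hps, h2⟩, ?_⟩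
    refine ⟨y + r p • a, ⟨?_, ?_⟩, (t - r p) • a,
      mem_segment_zero.2 ⟨t - r p, ⟨by linarith, by linarith [ht.2]⟩, rfl⟩, ?_⟩
    · intro q hq
      rw [inner_add_right, inner_smul_right]
      by_cases hqx : q.2 < (inner ℝ q.1 (y + t • a) : ℝ)
      · have hq' : q ∈ s.filter (fun p => p.2 < (inner ℝ p.1 (y + t • a) : ℝ)) :=
          Finset.mem_filter.2 ⟨hq, hqx⟩
        obtain ⟨h4, -, -⟩ := key q hq'
        have := (le_div_iff₀ h4).1 (hmin q hq')
        linarith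
      · have h5 := hy q hq
        rw [inner_add_right, inner_smul_right, not_lt] at hqx
        rcases le_total 0 (inner ℝ q.1 a : ℝ) with h6 | h6
        · have := mul_le_mul_of_nonneg_right h3 h6
          linarith
        · have := mul_nonpos_of_nonneg_of_nonpos h0 h6
          linarith
    · simp only [mem_ofPred_eq, inner_add_right, inner_smul_right, r]
      rw [div_mul_cancel₀ _ h2.ne']
      ring
    · simp only
      module
  · apply union_subset
    · intro x hx
      exact ⟨x, hx, 0, left_mem_segment _ _ _, add_zero x⟩
    · exact iUnion₂_subset fun p _ => Set.add_subset_add_right (facet_subset s p)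

theorem volume_polytope_add_segment {s : Finset (E × ℝ)} (hs : IsCompact (polytope s))
    (hu : ∀ p ∈ s, ‖p.1‖ = 1) (a : E) :
    volume (polytope s + segment ℝ 0 a) = volume (polytope s) +
      ∑ p ∈ s, ENNReal.ofReal (inner ℝ p.1 a) * volume (facet s p + segment ℝ 0 p.1) := by
  have hcomp : ∀ p : E × ℝ, IsCompact (facet s p + segment ℝ 0 a) := fun p =>
    (isCompact_facet hs p).add (isCompact_segment 0 a)
  have hsplit : ∀ p ∈ s.filter (fun p => 0 < (inner ℝ p.1 a : ℝ)), ∀ x ∈ facet s p, ∀ t : ℝ,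
      inner ℝ p.1 (x + t • a) = p.2 + t * inner ℝ p.1 a := by
    intro p _ x hx t
    rw [inner_add_right, inner_smul_right, hx.2]
  rw [polytope_add_segment, measure_union₀, measure_biUnion_finset₀]
  · congr 1
    rw [Finset.sum_filter]
    refine Finset.sum_congr rfl fun p hp => ?_
    split_ifs with h
    · exact volume_prism (fun x hx => hx.2) (hu p hp) h.le
    · rw [ENNReal.ofReal_of_nonpos (not_lt.1 h), zero_mul]
  · intro p hp q hq hpq
    have hp' := Finset.mem_filter.1 hp
    have hq' := Finset.mem_filter.1 hq
    -- Each base point satisfies the other facet's constraint, which forces equal times `r = t` and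
    -- hence a common base point.
    have hsub : (facet s p + segment ℝ 0 a) ∩ (facet s q + segment ℝ 0 a) ⊆
        (facet s p ∩ facet s q) + segment ℝ 0 a := by
      rintro _ ⟨⟨x, hx, _, hsx, rfl⟩, ⟨y, hy, _, hty, hxy⟩⟩
      obtain ⟨r, hr, rfl⟩ := mem_segment_zero.1 hsx
      obtain ⟨t, ht, rfl⟩ := mem_segment_zero.1 hty
      have hxy : y + t • a = x + r • a := hxy
      have e1 := hsplit p hp x hx r
      have e2 := hsplit q hq y hy t
      have l1 := hx.1 q hq'.1
      have l2 := hy.1 p hp'.1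
      rw [← hxy, inner_add_right, inner_smul_right] at e1
      rw [hxy, inner_add_right, inner_smul_right] at e2
      have h1 : (r - t) * inner ℝ p.1 a ≤ 0 := by linarith
      have h2 : (t - r) * inner ℝ q.1 a ≤ 0 := by linarith
      have h3 : r ≤ t := by
        by_contra hn
        have := mul_pos (sub_pos.2 (not_le.1 hn)) hp'.2
        linarith
      have h4 : t ≤ r := by
        by_contra hn
        have := mul_pos (sub_pos.2 (not_le.1 hn)) hq'.2
        linarith
      obtain rfl := le_antisymm h3 h4
      obtain rfl := add_right_cancel hxy
      exact ⟨y, ⟨hx, hy⟩, r • a, mem_segment_zero.2 ⟨r, hr, rfl⟩, rfl⟩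
    refine measure_mono_null hsub ?_
    rw [volume_prism (fun x hx => hx.1.2) (hu p hp'.1) hp'.2.le,
      volume_prism_inter_eq_zero (hu p hp'.1) (hu q hq'.1) hpq ?_ fun x hx => ⟨hx.1.2, hx.2.2⟩,
      mul_zero]
    intro hneg
    have := hp'.2
    rw [hneg, inner_neg_left] at this
    linarith [hq'.2]
  · exact fun p _ => (hcomp p).measurableSet.nullMeasurableSet
  · exact (Finset.measurableSet_biUnion _ fun p _ => (hcomp p).measurableSet).nullMeasurableSet
  · rw [AEDisjoint, inter_iUnion₂]
    refine (measure_biUnion_null_iff (Finset.countable_toSet _)).2 fun p hp => ?_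
    have hp' := Finset.mem_filter.1 hp
    have hp0 : p.1 ≠ 0 := by
      intro h
      simp [h] at hp'
    refine measure_mono_null ?_ (volume_hyperplane hp0 p.2)
    rintro _ ⟨hP, x, hx, _, hsx, rfl⟩
    obtain ⟨r, hr, rfl⟩ := mem_segment_zero.1 hsx
    have h1 := hP p hp'.1
    have e1 := hsplit p hp x hx r
    have e2 := mul_nonneg hr.1 hp'.2.le
    simp only [mem_ofPred_eq] at h1 ⊢
    linarith

/-- Cauchy's projection formula. As a function of `a`, the right-hand side is the support function
of a zonotope, which is how zonotopes enter. -/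
theorem sweep_polytope {s : Finset (E × ℝ)} (hs : IsCompact (polytope s))
    (hu : ∀ p ∈ s, ‖p.1‖ = 1) (a : E) :
    sweep (polytope s) a = ∑ p ∈ s, max (inner ℝ p.1 a) 0 * facetArea s p := by
  have hfin : ∀ p : E × ℝ, volume (facet s p + segment ℝ 0 p.1) ≠ ⊤ := fun p =>
    ((isCompact_facet hs p).add (isCompact_segment 0 p.1)).measure_lt_top.ne
  have hfin' : ∀ p ∈ s,
      ENNReal.ofReal (inner ℝ p.1 a) * volume (facet s p + segment ℝ 0 p.1) ≠ ⊤ := fun p _ =>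
    ENNReal.mul_ne_top ENNReal.ofReal_ne_top (hfin p)
  rw [sweep, measureReal_def, measureReal_def, volume_polytope_add_segment hs hu,
    ENNReal.toReal_add hs.measure_lt_top.ne (ENNReal.sum_ne_top.2 hfin'), ENNReal.toReal_sum hfin',
    add_sub_cancel_left]
  refine Finset.sum_congr rfl fun p _ => ?_
  rw [ENNReal.toReal_mul, ENNReal.toReal_ofReal', facetArea, measureReal_def]

theorem finrank_perp {u : E} (hu : u ≠ 0) :
    finrank ℝ (Submodule.span ℝ {u})ᗮ = finrank ℝ E - 1 := by
  rw [← (Submodule.span ℝ {u}).finrank_add_finrank_orthogonal, finrank_span_singleton hu,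
    Nat.add_sub_cancel_left]

/-- `F` is isometric to its projection to `u^⊥`, and a prism of height one has the measure of its
base. This links the Hausdorff measure in `surfaceArea` with Lebesgue measure. -/
theorem euclideanHausdorffMeasure_eq_volume_prism {F : Set E} {u : E} {h : ℝ}
    (hF : ∀ x ∈ F, inner ℝ u x = h) (hu : ‖u‖ = 1) (hc : IsCompact F) (hconv : Convex ℝ F) :
    μHE[finrank ℝ E - 1] F = volume (F + segment ℝ 0 u) := by
  have hu0 : u ≠ 0 := by
    rintro rfl
    simp at hu
  have huu : inner ℝ u u = (1 : ℝ) := by rw [real_inner_self_eq_norm_sq, hu]; norm_num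
  have hvol : volume F = 0 := measure_mono_null hF (volume_hyperplane hu0 h)
  rw [volume_add_segment hc hconv hu0, hvol, zero_add, ← ofReal_norm, hu, ENNReal.ofReal_one,
    one_mul, ← InnerProductSpace.euclideanHausdorffMeasure_eq_volume, finrank_perp hu0]
  have hiso : Isometry fun y : (Submodule.span ℝ {u})ᗮ => h • u + (y : E) :=
    (isometry_add_left (h • u)).comp isometry_subtype_coe
  rw [← hiso.euclideanHausdorffMeasure_image, image_image]
  congr 1
  have : ∀ x ∈ F, h • u + (perpProj u x : E) = x := by
    intro x hx
    obtain ⟨t, ht⟩ := exists_eq_perpProj_add_smul u x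
    have h1 := hF x hx
    have h2 : inner ℝ u (perpProj u x : E) = (0 : ℝ) :=
      Submodule.mem_orthogonal_singleton_iff_inner_right.1 (perpProj u x).2
    rw [ht, inner_add_right, inner_smul_right, huu, h2, zero_add, mul_one] at h1
    rw [← h1, add_comm, ← ht]
  rw [image_congr this, image_id']

theorem frontier_polytope {s : Finset (E × ℝ)} (hu : ∀ p ∈ s, ‖p.1‖ = 1) :
    frontier (polytope s) = ⋃ p ∈ s, facet s p := by
  rw [(isClosed_polytope s).frontier_eq]
  ext x
  simp only [Set.mem_sdiff, mem_iUnion₂, exists_prop]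
  constructor
  · rintro ⟨hx, hint⟩
    by_contra! hn
    apply hint
    have hopen : IsOpen (⋂ p ∈ s, {x : E | inner ℝ p.1 x < p.2}) :=
      isOpen_biInter_finset fun p _ => isOpen_lt (by fun_prop) continuous_const
    refine mem_interior.2 ⟨_, ?_, hopen, ?_⟩
    · intro y hy p hp
      exact (mem_iInter₂.1 hy p hp).le
    · refine mem_iInter₂.2 fun p hp => lt_of_le_of_ne (hx p hp) fun h => hn p hp ⟨hx, h⟩
  · rintro ⟨p, hp, hx⟩
    refine ⟨hx.1, fun hint => ?_⟩
    have hcont : Tendsto (fun t : ℝ => x + t • p.1) (𝓝[>] 0) (𝓝 x) := by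
      have : Continuous fun t : ℝ => x + t • p.1 := by fun_prop
      simpa using this.continuousAt.tendsto.mono_left (nhdsWithin_le_nhds (a := (0 : ℝ)))
    obtain ⟨t, ht, htp⟩ := ((hcont.eventually (mem_interior_iff_mem_nhds.1 hint)).and
      self_mem_nhdsWithin).exists
    have h1 := ht p hp
    have h2 : (0 : ℝ) < t := htp
    rw [inner_add_right, inner_smul_right, hx.2, real_inner_self_eq_norm_sq, hu p hp] at h1
    linarith

/-- Distinct facets could overlap in positive area only with opposite normals, and then the polytope
would be flat; `h0` rules this out. -/
theorem measure_frontier_polytope {s : Finset (E × ℝ)} (hs : IsCompact (polytope s))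
    (hu : ∀ p ∈ s, ‖p.1‖ = 1) (h0 : polytope s ∈ 𝓝 (0 : E)) :
    μHE[finrank ℝ E - 1] (frontier (polytope s)) =
      ∑ p ∈ s, volume (facet s p + segment ℝ 0 p.1) := by
  rw [frontier_polytope hu, measure_biUnion_finset₀]
  · refine Finset.sum_congr rfl fun p hp => ?_
    exact euclideanHausdorffMeasure_eq_volume_prism (fun x hx => hx.2) (hu p hp)
      (isCompact_facet hs p) (convex_facet s p)
  · intro p hp q hq hpq
    rw [Function.onFun, AEDisjoint]
    rcases (facet s p ∩ facet s q).eq_empty_or_nonempty with he | ⟨x, hx⟩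
    · simp [he]
    rw [euclideanHausdorffMeasure_eq_volume_prism (fun x hx => hx.1.2) (hu p hp)
      ((isCompact_facet hs p).inter (isCompact_facet hs q))
      ((convex_facet s p).inter (convex_facet s q))]
    refine volume_prism_inter_eq_zero (hu p hp) (hu q hq) hpq ?_ fun x hx => ⟨hx.1.2, hx.2.2⟩
    intro hneg
    have hp0 : p.1 ≠ 0 := by
      intro h
      have := hu p hp
      simp [h] at this
    have hsub : polytope s ⊆ {x : E | inner ℝ p.1 x = p.2} := by
      intro y hy
      have h1 := hy p hp
      have h2 := hy q hq
      have h3 : inner ℝ p.1 x = p.2 := hx.1.2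
      have h4 : inner ℝ q.1 x = q.2 := hx.2.2
      simp only [mem_ofPred_eq, hneg, inner_neg_left] at h1 h2 h3 h4 ⊢
      linarith
    exact (Measure.measure_pos_of_mem_nhds volume h0).ne'
      (measure_mono_null hsub (volume_hyperplane hp0 _))
  · exact fun p _ => (isCompact_facet hs p).measurableSet.nullMeasurableSet

theorem surfaceArea_polytope {s : Finset (E × ℝ)} (hs : IsCompact (polytope s))
    (hu : ∀ p ∈ s, ‖p.1‖ = 1) (h0 : polytope s ∈ 𝓝 (0 : E)) :
    surfaceArea (polytope s) = ∑ p ∈ s, facetArea s p := by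
  rw [surfaceArea, measureReal_def, measure_frontier_polytope hs hu h0, ENNReal.toReal_sum]
  · rfl
  · exact fun p _ => ((isCompact_facet hs p).add (isCompact_segment 0 p.1)).measure_lt_top.ne

end Polytope

/-! ### Polytope approximation and monotonicity of surface area. -/

section Body

variable {E : Type*} [NormedAddCommGroup E] [InnerProductSpace ℝ E]

/-- A compact convex neighborhood of the origin. -/
structure IsCentredBody (A : Set E) : Prop where
  isCompact : IsCompact A
  convex : Convex ℝ A
  mem_nhds : A ∈ 𝓝 (0 : E)

namespace IsCentredBody

variable {A B : Set E}

theorem zero_mem (hA : IsCentredBody A) : (0 : E) ∈ A := mem_of_mem_nhds hA.mem_nhds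

theorem smul (hA : IsCentredBody A) {r : ℝ} (hr : 0 < r) : IsCentredBody (r • A) where
  isCompact := hA.isCompact.smul r
  convex := hA.convex.smul r
  mem_nhds := (set_smul_mem_nhds_zero_iff hr.ne').2 hA.mem_nhds

theorem add (hA : IsCentredBody A) (hBc : IsCompact B) (hB : Convex ℝ B) (h0 : (0 : E) ∈ B) :
    IsCentredBody (A + B) where
  isCompact := hA.isCompact.add hBc
  convex := hA.convex.add hB
  mem_nhds := mem_of_superset hA.mem_nhds fun x hx => ⟨x, hx, 0, h0, add_zero x⟩

theorem subset_interior_smul (hA : IsCentredBody A) {r : ℝ} (hr : 1 < r) :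
    A ⊆ interior (r • A) := by
  have hr0 : (0 : ℝ) < r := by linarith
  intro x hx
  rw [interior_smul₀ hr0.ne', mem_smul_set_iff_inv_smul_mem₀ hr0.ne',
    ← gauge_lt_one_iff_mem_interior hA.convex hA.mem_nhds, gauge_smul_of_nonneg (by positivity),
    smul_eq_mul]
  calc r⁻¹ * gauge A x ≤ r⁻¹ * 1 := by
        gcongr
        exact gauge_le_one_of_mem hx
    _ < 1 := by rw [mul_one]; exact inv_lt_one_of_one_lt₀ hr

variable [FiniteDimensional ℝ E]

/-- Every body is contained in a polytope that is contained in a slightly larger copy of it. -/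
theorem exists_polytope (hA : IsCentredBody A) {r : ℝ} (hr : 1 < r) :
    ∃ s : Finset (E × ℝ), (∀ p ∈ s, ‖p.1‖ = 1) ∧ A ⊆ polytope s ∧ polytope s ⊆ r • A := by
  classical
  have hr0 : (0 : ℝ) < r := by linarith
  have hB := hA.smul hr0
  have hfc : IsCompact (frontier (r • A)) := hB.isCompact.of_isClosed_subset isClosed_frontier
    hB.isCompact.isClosed.frontier_subset
  have hsep : ∀ x ∈ frontier (r • A), ∃ p : E × ℝ, ‖p.1‖ = 1 ∧ (∀ a ∈ A, inner ℝ p.1 a ≤ p.2) ∧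
      p.2 < inner ℝ p.1 x := by
    intro x hx
    have hxA : x ∉ A := fun h => hx.2 (hA.subset_interior_smul hr h)
    obtain ⟨f, k, hf, hk⟩ :=
      geometric_hahn_banach_closed_point hA.convex hA.isCompact.isClosed hxA
    set v := (InnerProductSpace.toDual ℝ E).symm f with hv
    have hvf : ∀ y, inner ℝ v y = f y := fun y => InnerProductSpace.toDual_symm_apply
    have hk0 : 0 < k := by simpa using hf 0 hA.zero_mem
    have hv0 : 0 < ‖v‖ := by
      rw [norm_pos_iff]
      intro h
      have := hvf x
      rw [h, inner_zero_left] at this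
      linarith
    refine ⟨(‖v‖⁻¹ • v, ‖v‖⁻¹ * k), ?_, fun a ha => ?_, ?_⟩
    · rw [norm_smul, norm_inv, norm_norm, inv_mul_cancel₀ hv0.ne']
    · simp only [inner_smul_left, hvf, conj_trivial]
      exact mul_le_mul_of_nonneg_left (hf a ha).le (by positivity)
    · simp only [inner_smul_left, hvf, conj_trivial]
      exact mul_lt_mul_of_pos_left hk (by positivity)
  choose! p hp1 hp2 hp3 using hsep
  obtain ⟨t, ht, htc⟩ := hfc.elim_nhds_subcover (fun x => {y | (p x).2 < inner ℝ (p x).1 y})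
    fun x hx => (isOpen_lt continuous_const (by fun_prop)).mem_nhds (hp3 x hx)
  refine ⟨t.image p, ?_, ?_, ?_⟩
  · intro q hq
    obtain ⟨x, hx, rfl⟩ := Finset.mem_image.1 hq
    exact hp1 x (ht x hx)
  · intro a ha q hq
    obtain ⟨x, hx, rfl⟩ := Finset.mem_image.1 hq
    exact hp2 x (ht x hx) a ha
  · intro y hy
    by_contra hyB
    -- A point outside `r • A` is pulled back radially to the frontier, where one of the chosen
    -- half-spaces excludes it. That half-space contains 0, so it excludes `y` as well.
    set g := gauge (r • A) y with hg
    have hg1 : 1 < g := by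
      by_contra hn
      exact hyB (hB.isCompact.isClosed.closure_eq ▸
        (gauge_le_one_iff_mem_closure hB.convex hB.mem_nhds).1 (not_lt.1 hn))
    have hg0 : 0 < g := by linarith
    have hfr : g⁻¹ • y ∈ frontier (r • A) := by
      rw [← gauge_eq_one_iff_mem_frontier hB.convex hB.mem_nhds,
        gauge_smul_of_nonneg (by positivity), smul_eq_mul, ← hg, inv_mul_cancel₀ hg0.ne']
    obtain ⟨x, hxt, hx⟩ := mem_iUnion₂.1 (htc hfr)
    have h1 := hy (p x) (Finset.mem_image_of_mem p hxt)
    have h2 := hp2 x (ht x hxt) 0 hA.zero_mem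
    simp only [mem_ofPred_eq, inner_smul_right] at hx
    rw [inner_zero_right] at h2
    have h3 : g⁻¹ * inner ℝ (p x).1 y ≤ g⁻¹ * (p x).2 :=
      mul_le_mul_of_nonneg_left h1 (by positivity)
    have h4 : g⁻¹ * (p x).2 ≤ 1 * (p x).2 :=
      mul_le_mul_of_nonneg_right (inv_le_one_of_one_le₀ hg1.le) h2
    linarith

end IsCentredBody

variable [FiniteDimensional ℝ E] [MeasurableSpace E] [BorelSpace E]

/-- For nested convex bodies, the nearest point map sends the boundary of the larger one onto the
boundary of the smaller one. -/
theorem exists_lipschitz_frontier {A B : Set E} (hA : IsCentredBody A) (hB : IsCompact B)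
    (h : A ⊆ B) :
    ∃ f : E → E, LipschitzWith 1 f ∧ frontier A ⊆ f '' frontier B := by
  have hex : ∀ u : E, ∃ v ∈ A, ∀ w ∈ A, inner ℝ (u - v) (w - v) ≤ (0 : ℝ) := by
    intro u
    obtain ⟨v, hv, h⟩ := 
      exists_norm_eq_iInf_of_complete_convex ⟨0, hA.zero_mem⟩ hA.isCompact.isComplete hA.convex u
    exact ⟨v, hv, (norm_eq_iInf_iff_real_inner_le_zero hA.convex hv).1 h⟩
  choose f hfA hf using hex
  refine ⟨f, LipschitzWith.of_dist_le_mul fun x y => ?_, ?_⟩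
  · rw [NNReal.coe_one, one_mul, dist_eq_norm, dist_eq_norm]
    have h1 := hf x (f y) (hfA y)
    have h2 := hf y (f x) (hfA x)
    have h3 : ‖f x - f y‖ ^ 2 ≤ inner ℝ (x - y) (f x - f y) := by
      rw [← real_inner_self_eq_norm_sq]
      simp only [inner_sub_left, inner_sub_right] at h1 h2 ⊢
      linarith
    have h4 := real_inner_le_norm (x - y) (f x - f y)
    rcases (norm_nonneg (f x - f y)).eq_or_lt with h5 | h5
    · rw [← h5]; exact norm_nonneg _
    · have : ‖f x - f y‖ * ‖f x - f y‖ ≤ ‖x - y‖ * ‖f x - f y‖ := by nlinarith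
      exact le_of_mul_le_mul_right this h5
  · intro y hy
    have hyA : y ∈ A := hA.isCompact.isClosed.frontier_subset hy
    have huniq : ∀ x, (∀ w ∈ A, inner ℝ (x - y) (w - y) ≤ (0 : ℝ)) → f x = y := by
      intro x hx
      have h1 := hf x y hyA
      have h2 := hx (f x) (hfA x)
      have h3 : inner ℝ (f x - y) (f x - y) ≤ (0 : ℝ) := by
        simp only [inner_sub_left, inner_sub_right] at h1 h2 ⊢
        linarith
      rw [real_inner_self_nonpos, sub_eq_zero] at h3
      exact h3
    -- a nonzero outer normal of `A` at `y`
    obtain ⟨u, hu0, hu⟩ : ∃ u : E, u ≠ 0 ∧ ∀ w ∈ A, inner ℝ u (w - y) ≤ (0 : ℝ) := by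
      obtain ⟨g, hg0, hg⟩ := geometric_hahn_banach_of_nonempty_interior_point hA.convex hy.2
        ⟨0, mem_interior_iff_mem_nhds.2 hA.mem_nhds⟩
      refine ⟨(InnerProductSpace.toDual ℝ E).symm g, by simpa using hg0, fun w hw => ?_⟩
      rw [InnerProductSpace.toDual_symm_apply, map_sub]
      exact sub_nonpos.2 (hg w hw)
    -- The last point of `B` on the normal ray from `y` lies on the frontier of `B`, and its nearest
    -- point in `A` is `y`.
    obtain ⟨t, ht0, ht⟩ : ∃ t : ℝ, 0 ≤ t ∧ y + t • u ∈ frontier B := by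
      have hcont : Continuous fun t : ℝ => y + t • u := by fun_prop
      have hT : IsCompact (Ici (0 : ℝ) ∩ (fun t : ℝ => y + t • u) ⁻¹' B) := by
        have hemb : IsClosedEmbedding fun t : ℝ => y + t • u :=
          (Homeomorph.addLeft y).isClosedEmbedding.comp (isClosedEmbedding_smul_left hu0)
        exact (hemb.isCompact_preimage hB).inter_left isClosed_Ici
      obtain ⟨t, ht, hmax⟩ := hT.exists_isGreatest
        ⟨0, self_mem_Ici, by simpa using h hyA⟩
      refine ⟨t, ht.1, subset_closure ht.2, fun hint => ?_⟩
      have hev : ∀ᶠ r in 𝓝[>] t, y + r • u ∈ B :=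
        (hcont.continuousAt.mono_left (nhdsWithin_le_nhds (s := Ioi t))).eventually
          (mem_interior_iff_mem_nhds.1 hint)
      obtain ⟨r, hr, htr⟩ := (hev.and self_mem_nhdsWithin).exists
      have htr : t < r := htr
      exact absurd (hmax ⟨(ht.1.trans htr.le : (0 : ℝ) ≤ r), hr⟩) (not_le.2 htr)
    refine ⟨y + t • u, ht, huniq _ fun w hw => ?_⟩
    rw [add_sub_cancel_left, inner_smul_left]
    exact mul_nonpos_of_nonneg_of_nonpos ht0 (hu w hw)

theorem measure_frontier_mono {A B : Set E} (hA : IsCentredBody A) (hB : IsCompact B)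
    (h : A ⊆ B) (d : ℕ) :
    (μHE[d] : Measure E) (frontier A) ≤ μHE[d] (frontier B) := by
  obtain ⟨f, hf, hsub⟩ := exists_lipschitz_frontier hA hB h
  refine (measure_mono hsub).trans ?_
  simp only [Measure.euclideanHausdorffMeasure_def, Measure.smul_apply]
  have := hf.hausdorffMeasure_image_le (Nat.cast_nonneg d) (frontier B)
  rw [ENNReal.coe_one, ENNReal.one_rpow, one_mul] at this
  exact smul_le_smul_of_nonneg_left this zero_le

namespace IsCentredBody

variable {A B : Set E}

/-- Needed because `surfaceArea` is real-valued and would turn an infinite measure into 0. -/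
theorem measure_frontier_ne_top (hA : IsCentredBody A) :
    (μHE[finrank ℝ E - 1] : Measure E) (frontier A) ≠ ⊤ := by
  obtain ⟨s, hu, h1, h2⟩ := hA.exists_polytope one_lt_two
  have hs : IsCompact (polytope s) :=
    (hA.smul two_pos).isCompact.of_isClosed_subset (isClosed_polytope s) h2
  refine ne_top_of_le_ne_top ?_
    (measure_frontier_mono hA hs h1 _)
  rw [measure_frontier_polytope hs hu (mem_of_superset hA.mem_nhds h1)]
  exact ENNReal.sum_ne_top.2 fun p _ =>
    ((isCompact_facet hs p).add (isCompact_segment 0 p.1)).measure_lt_top.ne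

theorem surfaceArea_mono (hA : IsCentredBody A) (hB : IsCentredBody B) (h : A ⊆ B) :
    surfaceArea A ≤ surfaceArea B :=
  ENNReal.toReal_mono hB.measure_frontier_ne_top
    (measure_frontier_mono hA hB.isCompact h _)

end IsCentredBody

theorem surfaceArea_nonneg (A : Set E) : 0 ≤ surfaceArea A := measureReal_nonneg

theorem surfaceArea_smul {r : ℝ} (hr : 0 < r) (A : Set E) :
    surfaceArea (r • A) = r ^ (finrank ℝ E - 1) * surfaceArea A := by
  have hfr : frontier (r • A) = r • frontier A :=
    ((Homeomorph.smulOfNeZero r hr.ne').image_frontier A).symm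
  rw [surfaceArea, hfr, measureReal_def, Measure.euclideanHausdorffMeasure_smul₀ _ hr.ne',
    surfaceArea, measureReal_def, ENNReal.smul_def, smul_eq_mul, ENNReal.toReal_mul]
  simp [Real.norm_of_nonneg hr.le]

end Body

/-! ### Elementary limits and power estimates. -/

theorem le_of_forall_pos_le_continuous {f : ℝ → ℝ} (hf : Continuous f) {x a : ℝ}
    (h : ∀ s, a < s → x ≤ f s) : x ≤ f a :=
  ge_of_tendsto (hf.continuousAt.mono_left (nhdsWithin_le_nhds (s := Ioi a)))
    (eventually_nhdsWithin_of_forall h)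

theorem exists_one_lt_pow_lt {η : ℝ} (hη : 1 < η) (k : ℕ) : ∃ r : ℝ, 1 < r ∧ r ^ k < η := by
  have hc : Continuous fun r : ℝ => r ^ k := by fun_prop
  have h : ∀ᶠ r in 𝓝[>] (1 : ℝ), r ^ k < η :=
    (hc.continuousAt.mono_left (nhdsWithin_le_nhds (s := Ioi (1 : ℝ)))).eventually
      (gt_mem_nhds (by simpa using hη))
  obtain ⟨r, hr, h1⟩ := (h.and self_mem_nhdsWithin).exists
  exact ⟨r, h1, hr⟩

/-- An upper companion of Bernoulli's inequality; after division by `s` the bound tends to `k` as `s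
→ 0`. -/
theorem one_add_pow_sub_one_le (k : ℕ) {s : ℝ} (hs : 0 ≤ s) :
    (1 + s) ^ k - 1 ≤ k * s * (1 + s) ^ k := by
  induction k with
  | zero => simp
  | succ k ih =>
    have h1 : (1 : ℝ) ≤ (1 + s) ^ (k + 1) := one_le_pow₀ (by linarith)
    have h2 : (1 + s) * ((1 + s) ^ k - 1) ≤ (1 + s) * (k * s * (1 + s) ^ k) :=
      mul_le_mul_of_nonneg_left ih (by linarith)
    have h3 : s ≤ s * (1 + s) ^ (k + 1) := le_mul_of_one_le_right hs h1
    push_cast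
    rw [pow_succ] at h3 ⊢
    nlinarith

/-! ### Zonotopes, telescoping and discrete mixed volumes. -/

section Zonotope

variable {E : Type*} [NormedAddCommGroup E] [InnerProductSpace ℝ E]

/-- The Minkowski sum of the segments `[0, a]` with `a ∈ l`. -/
def zonotope : List E → Set E
  | [] => {0}
  | a :: l => segment ℝ 0 a + zonotope l

/-- The support function of `zonotope l`. -/
def zonotopeSupport (l : List E) (x : E) : ℝ := (l.map fun a => max (inner ℝ x a : ℝ) 0).sum

theorem isCompact_zonotope (l : List E) : IsCompact (zonotope l) := by
  induction l with
  | nil => exact isCompact_singleton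
  | cons a l ih => exact (isCompact_segment 0 a).add ih

theorem convex_zonotope (l : List E) : Convex ℝ (zonotope l) := by
  induction l with
  | nil => exact convex_singleton 0
  | cons a l ih => exact (convex_segment 0 a).add ih

theorem zero_mem_zonotope (l : List E) : (0 : E) ∈ zonotope l := by
  induction l with
  | nil => exact mem_singleton 0
  | cons a l ih => exact ⟨0, left_mem_segment _ _ _, 0, ih, add_zero 0⟩

theorem zonotope_map {F : Type*} [NormedAddCommGroup F] [InnerProductSpace ℝ F] (f : E →ₗ[ℝ] F)
    (l : List E) : zonotope (l.map f) = f '' zonotope l := by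
  induction l with
  | nil => simp [zonotope]
  | cons a l ih =>
    rw [List.map_cons, zonotope, zonotope, ih, Set.image_add, ← LinearMap.coe_toAffineMap,
      image_segment]
    simp

theorem zonotope_smul (r : ℝ) (l : List E) : zonotope (l.map (r • ·)) = r • zonotope l :=
  zonotope_map (r • (LinearMap.id : E →ₗ[ℝ] E)) l

theorem inner_le_zonotopeSupport {l : List E} (x : E) {y : E} (hy : y ∈ zonotope l) :
    inner ℝ x y ≤ zonotopeSupport l x := by
  induction l generalizing y with
  | nil =>
    obtain rfl : y = 0 := hy
    simp [zonotopeSupport]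
  | cons a l ih =>
    obtain ⟨_, hs, z, hz, rfl⟩ := hy
    obtain ⟨t, ht, rfl⟩ := mem_segment_zero.1 hs
    rw [inner_add_right, inner_smul_right, zonotopeSupport, List.map_cons, List.sum_cons]
    refine add_le_add ?_ (ih hz)
    rcases le_total 0 (inner ℝ x a : ℝ) with h | h
    · exact (mul_le_of_le_one_left h ht.2).trans (le_max_left _ _)
    · exact (mul_nonpos_of_nonneg_of_nonpos ht.1 h).trans (le_max_right _ _)

theorem exists_mem_zonotope_inner_eq (l : List E) (x : E) :
    ∃ y ∈ zonotope l, inner ℝ x y = zonotopeSupport l x := by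
  induction l with
  | nil => exact ⟨0, mem_singleton 0, by simp [zonotopeSupport]⟩
  | cons a l ih =>
    obtain ⟨y, hy, h⟩ := ih
    simp only [zonotopeSupport, List.map_cons, List.sum_cons] at h ⊢
    rcases le_total 0 (inner ℝ x a : ℝ) with ha | ha
    · exact ⟨a + y, ⟨a, right_mem_segment _ _ _, y, hy, rfl⟩, by
        rw [inner_add_right, h, max_eq_left ha]⟩
    · exact ⟨0 + y, ⟨0, left_mem_segment _ _ _, y, hy, rfl⟩, by
        rw [inner_add_right, h, max_eq_right ha, inner_zero_right]⟩

theorem zonotopeSupport_map_smul {r : ℝ} (hr : 0 ≤ r) (l : List E) (x : E) :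
    zonotopeSupport (l.map (r • ·)) x = r * zonotopeSupport l x := by
  rw [zonotopeSupport, zonotopeSupport, ← List.sum_map_mul_left, List.map_map]
  congr 2
  ext a
  simp only [Function.comp_apply, inner_smul_right]
  rw [mul_max_of_nonneg _ _ hr, mul_zero]

theorem zonotopeSupport_add_le (l : List E) (x y : E) :
    zonotopeSupport l (x + y) ≤ zonotopeSupport l x + zonotopeSupport l y := by
  obtain ⟨z, hz, h⟩ := exists_mem_zonotope_inner_eq l (x + y)
  rw [← h, inner_add_left]
  exact add_le_add (inner_le_zonotopeSupport x hz) (inner_le_zonotopeSupport y hz)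

/-- A compact convex set is determined by its support function. -/
theorem subset_of_forall_inner_le [FiniteDimensional ℝ E] {A B : Set E} (hB : Convex ℝ B)
    (hBc : IsCompact B) (h : ∀ x : E, ∀ y ∈ A, ∃ z ∈ B, (inner ℝ x y : ℝ) ≤ inner ℝ x z) :
    A ⊆ B := by
  intro y hy
  by_contra hyB
  obtain ⟨f, k, hf, hk⟩ := geometric_hahn_banach_closed_point hB hBc.isClosed hyB
  obtain ⟨z, hz, hle⟩ := h ((InnerProductSpace.toDual ℝ E).symm f) y hy
  rw [InnerProductSpace.toDual_symm_apply, InnerProductSpace.toDual_symm_apply] at hle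
  linarith [hf z hz]

/-- The segments are added one at a time; by `hΦ` each increment lies between the one at `A` and the
one at the final body. Applied to the segments `s • a` with `s → 0`, this replaces differentiation
of `Φ (A + s • Z)`. It is used for volume and for `sweep · c`. -/
theorem telescope_zonotope {Φ : Set E → ℝ}
    (hΦ : ∀ (A B : Set E) (a : E), IsCompact A → Convex ℝ A → IsCompact B → Convex ℝ B → A ⊆ B →
      Φ (A + segment ℝ 0 a) - Φ A ≤ Φ (B + segment ℝ 0 a) - Φ B)
    (l : List E) {A : Set E} (hAc : IsCompact A) (hA : Convex ℝ A) :
    (l.map fun a => Φ (A + segment ℝ 0 a) - Φ A).sum ≤ Φ (A + zonotope l) - Φ A ∧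
    Φ (A + zonotope l) - Φ A ≤
      (l.map fun a => Φ (A + zonotope l + segment ℝ 0 a) - Φ (A + zonotope l)).sum := by
  induction l generalizing A with
  | nil => simp [zonotope]
  | cons a l ih =>
    have hc' := hAc.add (isCompact_segment 0 a)
    have hA' := hA.add (convex_segment 0 a)
    have hsub : A ⊆ A + segment ℝ 0 a := fun x hx => ⟨x, hx, 0, left_mem_segment _ _ _, add_zero x⟩
    obtain ⟨h1, h2⟩ := ih hc' hA'
    rw [zonotope, ← add_assoc, List.map_cons, List.sum_cons, List.map_cons, List.sum_cons]
    have h3 : (l.map fun b => Φ (A + segment ℝ 0 b) - Φ A).sum ≤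
        (l.map fun b => Φ (A + segment ℝ 0 a + segment ℝ 0 b) - Φ (A + segment ℝ 0 a)).sum :=
      List.sum_le_sum fun b _ => hΦ _ _ b hAc hA hc' hA' hsub
    have h4 := hΦ A (A + segment ℝ 0 a + zonotope l) a hAc hA (hc'.add (isCompact_zonotope l))
      (hA'.add (convex_zonotope l))
      (hsub.trans fun x hx => ⟨x, hx, 0, zero_mem_zonotope l, add_zero x⟩)
    constructor <;> linarith

variable [FiniteDimensional ℝ E] [MeasurableSpace E] [BorelSpace E]

theorem volume_add_zonotope (l : List E) {A : Set E} (hAc : IsCompact A) (hA : Convex ℝ A) :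
    (l.map (sweep A)).sum ≤ volume.real (A + zonotope l) - volume.real A ∧
    volume.real (A + zonotope l) - volume.real A ≤ (l.map (sweep (A + zonotope l))).sum :=
  telescope_zonotope (fun _ _ a hAc hA hBc hB h => sweep_mono hAc hA hBc hB h a) l hAc hA

theorem sweep_add_segment_sub_mono {A B : Set E} (hAc : IsCompact A) (hA : Convex ℝ A)
    (hBc : IsCompact B) (hB : Convex ℝ B) (h : A ⊆ B) (a c : E) :
    sweep (A + segment ℝ 0 a) c - sweep A c ≤ sweep (B + segment ℝ 0 a) c - sweep B c := by
  rw [sweep_add_segment_sub hAc hA, sweep_add_segment_sub hBc hB]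
  have hcont := (perpProj a).continuous
  exact mul_le_mul_of_nonneg_left (sweep_mono (hAc.image hcont)
    (hA.is_linear_image (perpProj a).toLinearMap.isLinear) (hBc.image hcont)
    (hB.is_linear_image (perpProj a).toLinearMap.isLinear) (image_mono h) _) (norm_nonneg _)

/-- By symmetry of the second difference, homogeneity of `sweep` in the segment applies to `a`. -/
theorem sweep_add_segment_sub_smul {A : Set E} (hAc : IsCompact A) (hA : Convex ℝ A) {s : ℝ}
    (hs : 0 ≤ s) (a c : E) : sweep (A + segment ℝ 0 (s • a)) c - sweep A c =
      s * (sweep (A + segment ℝ 0 a) c - sweep A c) := by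
  have h1 : ∀ b, sweep (A + segment ℝ 0 b) c - sweep A c =
      sweep (A + segment ℝ 0 c) b - sweep A b := by
    intro b
    simp only [sweep, add_right_comm A]
    ring
  rw [h1, h1, sweep_smul_right (hAc.add (isCompact_segment 0 c)) (hA.add (convex_segment 0 c)) hs,
    sweep_smul_right hAc hA hs, mul_sub]

theorem smul_add_smul_of_convex {A : Set E} (hA : Convex ℝ A) {s : ℝ} (hs : 0 ≤ s) :
    (1 + s) • A = A + s • A := by
  rw [hA.add_smul zero_le_one hs, one_smul]

/-- Euler's identity for the homogeneous function `sweep · c`, evaluated at a zonotope. -/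
theorem sum_sweep_projection_le [Nontrivial E] (l : List E) (c : E) :
    (l.map fun a => ‖a‖ * sweep (perpProj a '' zonotope l) (perpProj a c)).sum ≤
      ((finrank ℝ E - 1 : ℕ) : ℝ) * sweep (zonotope l) c := by
  set Z := zonotope l with hZ
  set k := finrank ℝ E - 1
  have hc : IsCompact Z := isCompact_zonotope l
  have hconv : Convex ℝ Z := convex_zonotope l
  have hnn : 0 ≤ sweep Z c := sweep_nonneg hc hconv c
  have key : ∀ s : ℝ, 0 < s →
      (l.map fun a => ‖a‖ * sweep (perpProj a '' Z) (perpProj a c)).sum ≤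
        k * (1 + s) ^ k * sweep Z c := by
    intro s hs
    -- Since `Z + s • Z = (1 + s) • Z`, the total increment is known by homogeneity; dividing by `s`
    -- and letting `s → 0` gives the factor `k`.
    have h := (telescope_zonotope (Φ := fun A => sweep A c) (fun _ _ a hAc hA hBc hB h =>
      sweep_add_segment_sub_mono hAc hA hBc hB h a c) (l.map (s • ·)) hc hconv).1
    rw [zonotope_smul, ← hZ, ← smul_add_smul_of_convex hconv hs.le,
      sweep_smul_left hc hconv (by linarith), List.map_map] at h
    have h2 : ((fun a => sweep (Z + segment ℝ 0 a) c - sweep Z c) ∘ fun x => s • x) =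
        fun a => s * (‖a‖ * sweep (perpProj a '' Z) (perpProj a c)) := by
      ext a
      rw [Function.comp_apply, sweep_add_segment_sub_smul hc hconv hs.le,
        sweep_add_segment_sub hc hconv]
    rw [h2, List.sum_map_mul_left] at h
    have h3 := mul_le_mul_of_nonneg_right (one_add_pow_sub_one_le k hs.le) hnn
    refine le_of_mul_le_mul_left ?_ hs
    calc _ ≤ (1 + s) ^ k * sweep Z c - sweep Z c := h
      _ ≤ k * s * (1 + s) ^ k * sweep Z c := by linarith
      _ = _ := by ring
  have := le_of_forall_pos_le_continuous (f := fun s : ℝ => k * (1 + s) ^ k * sweep Z c)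
    (by fun_prop) key
  simpa using this

/-- The zonotope spanned by `l` is between the unit ball and its dilate by `η`. -/
def IsNearUnitBall (η : ℝ) (l : List E) : Prop :=
  ∀ x, ‖x‖ ≤ zonotopeSupport l x ∧ zonotopeSupport l x ≤ η * ‖x‖

/-- For `y` in the hyperplane, projecting a generator does not change its inner product with `y`.
One list thus serves Cauchy's formula in every hyperplane at once. -/
theorem IsNearUnitBall.map_perpProj {η : ℝ} {l : List E} (h : IsNearUnitBall η l) (a : E) :
    IsNearUnitBall η (l.map (perpProj a)) := by
  intro y
  have : zonotopeSupport (l.map (perpProj a)) y = zonotopeSupport l (y : E) := by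
    rw [zonotopeSupport, zonotopeSupport, List.map_map]
    congr 2
    ext c
    rw [Function.comp_apply, Submodule.inner_orthogonalProjectionOnto_eq_of_mem_left]
  rw [this]
  exact h y

theorem sum_sweep_polytope {s : Finset (E × ℝ)} (hs : IsCompact (polytope s))
    (hu : ∀ p ∈ s, ‖p.1‖ = 1) (l : List E) :
    (l.map (sweep (polytope s))).sum = ∑ p ∈ s, facetArea s p * zonotopeSupport l p.1 := by
  have : sweep (polytope s) = fun a => ∑ p ∈ s, max (inner ℝ p.1 a) 0 * facetArea s p :=
    funext (sweep_polytope hs hu)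
  rw [this]
  simp only [zonotopeSupport]
  induction l with
  | nil => simp
  | cons a l ih =>
    simp only [List.map_cons, List.sum_cons, mul_add, Finset.sum_add_distrib, ih]
    congr 1
    exact Finset.sum_congr rfl fun p _ => mul_comm _ _

/-- A discrete form of Cauchy's surface area formula. -/
theorem IsNearUnitBall.surfaceArea_le [Nontrivial E] {η : ℝ} {l : List E}
    (h : IsNearUnitBall η l) {A : Set E} (hA : IsCentredBody A) :
    surfaceArea A ≤ (l.map (sweep A)).sum ∧ (l.map (sweep A)).sum ≤ η * surfaceArea A := by
  -- For a polytope the sum is the sum of the facet areas weighted by `zonotopeSupport l` at the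
  -- unit normals, and these weights lie in `[1, η]`. A general body is squeezed between a polytope
  -- and its dilate.
  have key : ∀ r : ℝ, 1 < r →
      surfaceArea A ≤ r ^ (finrank ℝ E - 1) * (l.map (sweep A)).sum ∧
      (l.map (sweep A)).sum ≤ r ^ (finrank ℝ E - 1) * (η * surfaceArea A) := by
    intro r hr
    have hr0 : (0 : ℝ) < r := by linarith
    obtain ⟨s, hu, h1, h2⟩ := hA.exists_polytope hr
    have hs : IsCompact (polytope s) :=
      (hA.smul hr0).isCompact.of_isClosed_subset (isClosed_polytope s) h2
    have hP : IsCentredBody (polytope s) :=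
      ⟨hs, convex_polytope s, mem_of_superset hA.mem_nhds h1⟩
    have hsum := sum_sweep_polytope hs hu l
    have hS := surfaceArea_polytope hs hu hP.mem_nhds
    have hB := hA.smul hr0
    have e1 : surfaceArea (polytope s) ≤ (l.map (sweep (polytope s))).sum := by
      rw [hsum, hS]
      refine Finset.sum_le_sum fun p hp => le_mul_of_one_le_right (facetArea_nonneg s p) ?_
      exact (hu p hp) ▸ (h p.1).1
    have e2 : (l.map (sweep (polytope s))).sum ≤ η * surfaceArea (polytope s) := by
      rw [hsum, hS, Finset.mul_sum]
      refine Finset.sum_le_sum fun p hp => ?_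
      rw [mul_comm]
      refine mul_le_mul_of_nonneg_right ?_ (facetArea_nonneg s p)
      have := (h p.1).2
      rwa [hu p hp, mul_one] at this
    have hη : 0 ≤ η := by
      obtain ⟨x, hx⟩ := exists_ne (0 : E)
      have h3 := (h x).1.trans (h x).2
      have h4 := norm_pos_iff.2 hx
      by_contra hn
      have := mul_neg_of_neg_of_pos (not_le.1 hn) h4
      linarith
    have e3 := hA.surfaceArea_mono hP h1
    have e4 := hP.surfaceArea_mono hB h2
    rw [surfaceArea_smul hr0] at e4
    have e5 : (l.map (sweep A)).sum ≤ (l.map (sweep (polytope s))).sum :=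
      List.sum_le_sum fun c _ => sweep_mono hA.isCompact hA.convex hs hP.convex h1 c
    have e6 : (l.map (sweep (polytope s))).sum ≤
        r ^ (finrank ℝ E - 1) * (l.map (sweep A)).sum := by
      rw [← List.sum_map_mul_left]
      refine List.sum_le_sum fun c _ => ?_
      rw [← sweep_smul_left hA.isCompact hA.convex hr0]
      exact sweep_mono hs hP.convex hB.isCompact hB.convex h2 c
    have e7 := mul_le_mul_of_nonneg_left e4 hη
    exact ⟨by linarith, by linarith⟩
  have c1 := le_of_forall_pos_le_continuous
    (f := fun r : ℝ => r ^ (finrank ℝ E - 1) * (l.map (sweep A)).sum) (by fun_prop)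
    fun r hr => (key r hr).1
  have c2 := le_of_forall_pos_le_continuous
    (f := fun r : ℝ => r ^ (finrank ℝ E - 1) * (η * surfaceArea A)) (by fun_prop)
    fun r hr => (key r hr).2
  simp only [one_pow, one_mul] at c1 c2
  exact ⟨c1, c2⟩

/-- The function `sweep A` is nearly the support function of a zonotope. -/
theorem IsCentredBody.exists_zonotopeSupport [Nontrivial E] {A : Set E} (hA : IsCentredBody A)
    {η : ℝ} (hη : 1 < η) :
    ∃ l : List E, ∀ x, sweep A x ≤ zonotopeSupport l x ∧ zonotopeSupport l x ≤ η * sweep A x := by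
  obtain ⟨r, hr, hrη⟩ := exists_one_lt_pow_lt hη (finrank ℝ E - 1)
  have hr0 : (0 : ℝ) < r := by linarith
  obtain ⟨s, hu, h1, h2⟩ := hA.exists_polytope hr
  have hs : IsCompact (polytope s) :=
    (hA.smul hr0).isCompact.of_isClosed_subset (isClosed_polytope s) h2
  refine ⟨s.toList.map fun p => facetArea s p • p.1, fun x => ?_⟩
  have hx : zonotopeSupport (s.toList.map fun p => facetArea s p • p.1) x =
      sweep (polytope s) x := by
    rw [sweep_polytope hs hu, zonotopeSupport, List.map_map, Finset.sum_map_toList]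
    refine Finset.sum_congr rfl fun p _ => ?_
    rw [Function.comp_apply, inner_smul_right, max_mul_of_nonneg _ _ (facetArea_nonneg s p),
      zero_mul, real_inner_comm, mul_comm]
  rw [hx]
  refine ⟨sweep_mono hA.isCompact hA.convex hs (convex_polytope s) h1 x, ?_⟩
  calc sweep (polytope s) x ≤ sweep (r • A) x :=
        sweep_mono hs (convex_polytope s) (hA.smul hr0).isCompact (hA.smul hr0).convex h2 x
    _ = r ^ (finrank ℝ E - 1) * sweep A x := sweep_smul_left hA.isCompact hA.convex hr0 x
    _ ≤ η * sweep A x :=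
        mul_le_mul_of_nonneg_right hrη.le (sweep_nonneg hA.isCompact hA.convex x)

/-- Up to a factor `η`, `sweep A` is a support function, and support functions are subadditive. -/
theorem IsCentredBody.sweep_add_le [Nontrivial E] {A : Set E} (hA : IsCentredBody A) (x y : E) :
    sweep A (x + y) ≤ sweep A x + sweep A y := by
  have key : ∀ η : ℝ, 1 < η → sweep A (x + y) ≤ η * (sweep A x + sweep A y) := by
    intro η hη
    obtain ⟨l, hl⟩ := hA.exists_zonotopeSupport hη
    linarith [(hl (x + y)).1, zonotopeSupport_add_le l x y, (hl x).2, (hl y).2]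
  have := le_of_forall_pos_le_continuous
    (f := fun η : ℝ => η * (sweep A x + sweep A y)) (by fun_prop) key
  simpa using this

theorem IsCentredBody.continuous_sweep [Nontrivial E] {A : Set E} (hA : IsCentredBody A) :
    Continuous (sweep A) := by
  have h : ConvexOn ℝ univ (sweep A) := by
    refine ⟨convex_univ, fun x _ y _ a b ha hb _ => ?_⟩
    refine (hA.sweep_add_le _ _).trans ?_
    rw [sweep_smul_right hA.isCompact hA.convex ha, sweep_smul_right hA.isCompact hA.convex hb]
    rfl
  exact continuousOn_univ.1 (h.continuousOn isOpen_univ)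

end Zonotope

/-! ### The Prékopa–Leindler and Brunn–Minkowski inequalities. -/

section PrekopaLeindler

/-- Brunn–Minkowski on the line: for compact `K` and `L`, the translates of `K` by `min L` and of
`L` by `max K` both lie in `C` and share at most one point. Inner regularity handles measurable
sets; nothing is asked of `C`. -/
theorem Real.volume_add_le_of_add_mem {A B C : Set ℝ} (hA : MeasurableSet A) (hB : MeasurableSet B)
    (hAne : A.Nonempty) (hBne : B.Nonempty) (h : ∀ a ∈ A, ∀ b ∈ B, a + b ∈ C) :
    volume A + volume B ≤ volume C := by
  have key : ∀ K L : Set ℝ, IsCompact K → IsCompact L → K ⊆ A → L ⊆ B → K.Nonempty → L.Nonempty →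
      volume K + volume L ≤ volume C := by
    intro K L hK hL hKA hLB hKne hLne
    obtain ⟨k, hk, hkmax⟩ := hK.exists_isGreatest hKne
    obtain ⟨l, hl, hlmin⟩ := hL.exists_isLeast hLne
    have e1 : volume K = volume (l +ᵥ K) := (measure_vadd volume l K).symm
    have e2 : volume L = volume (k +ᵥ L) := (measure_vadd volume k L).symm
    have hd : AEDisjoint volume (l +ᵥ K) (k +ᵥ L) := by
      refine measure_mono_null (t := {k + l}) ?_ (by simp)
      rintro _ ⟨⟨x, hx, rfl⟩, ⟨y, hy, hxy⟩⟩
      have h1 := hkmax hx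
      have h2 := hlmin hy
      simp only [vadd_eq_add, mem_singleton_iff] at hxy ⊢
      linarith
    rw [e1, e2, ← measure_union₀ (hL.vadd k).measurableSet.nullMeasurableSet hd]
    refine measure_mono (union_subset ?_ ?_)
    · rintro _ ⟨x, hx, rfl⟩
      simp only [vadd_eq_add]
      rw [add_comm]
      exact h x (hKA hx) l (hLB hl)
    · rintro _ ⟨y, hy, rfl⟩
      exact h k (hKA hk) y (hLB hy)
  obtain ⟨a, ha⟩ := hAne
  obtain ⟨b, hb⟩ := hBne
  have key' : ∀ K L : Set ℝ, IsCompact K → IsCompact L → K ⊆ A → L ⊆ B →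
      volume K + volume L ≤ volume C := by
    intro K L hK hL hKA hLB
    refine le_trans ?_ (key (insert a K) (insert b L) (hK.insert a) (hL.insert b)
      (insert_subset ha hKA) (insert_subset hb hLB) (insert_nonempty _ _) (insert_nonempty _ _))
    gcongr <;> exact subset_insert _ _
  refine le_of_forall_lt fun r hr => ?_
  rcases eq_or_ne (volume A) 0 with hA0 | hA0
  · rw [hA0, zero_add] at hr
    obtain ⟨L, hLB, hL, hrL⟩ := hB.exists_lt_isCompact hr
    have := key' ∅ L isCompact_empty hL (empty_subset _) hLB
    rw [measure_empty, zero_add] at this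
    exact hrL.trans_le this
  rcases eq_or_ne (volume B) 0 with hB0 | hB0
  · rw [hB0, add_zero] at hr
    obtain ⟨K, hKA, hK, hrK⟩ := hA.exists_lt_isCompact hr
    have := key' K ∅ hK isCompact_empty hKA (empty_subset _)
    rw [measure_empty, add_zero] at this
    exact hrK.trans_le this
  obtain ⟨r1, h1, r2, h2, h12⟩ := ENNReal.exists_lt_add_of_lt_add hr hA0 hB0
  obtain ⟨K, hKA, hK, hrK⟩ := hA.exists_lt_isCompact h1
  obtain ⟨L, hLB, hL, hrL⟩ := hB.exists_lt_isCompact h2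
  exact (h12.trans (ENNReal.add_lt_add hrK hrL)).trans_le (key' K L hK hL hKA hLB)

theorem lintegral_ofReal_eq_lintegral_Ioo {φ : ℝ → ℝ} (hφ : Measurable φ) (h0 : ∀ x, 0 ≤ φ x)
    (h1 : ∀ x, φ x ≤ 1) :
    ∫⁻ x, ENNReal.ofReal (φ x) = ∫⁻ t in Ioo (0 : ℝ) 1, volume {x | t < φ x} := by
  rw [lintegral_eq_lintegral_meas_lt volume (Eventually.of_forall h0) hφ.aemeasurable]
  rw [← lintegral_indicator measurableSet_Ioi, ← lintegral_indicator measurableSet_Ioo]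
  congr with t
  rcases lt_or_ge t 1 with ht | ht
  · simp [indicator_apply, ht]
  · have : {x | t < φ x} = ∅ := by
      ext x
      simp only [mem_ofPred_eq, mem_empty_iff_false, iff_false, not_lt]
      exact (h1 x).trans ht
    simp [indicator_apply, this]

/-- Layer cake: with both suprema equal to 1, the superlevel sets at each `t < 1` are nonempty, and
one-dimensional Brunn–Minkowski applies level by level. -/
theorem prekopaLeindler_real_normalized {φ ψ χ : ℝ → ℝ} (hφ : Measurable φ) (hψ : Measurable ψ)
    (hχ : Measurable χ) (hφ0 : ∀ x, 0 ≤ φ x) (hψ0 : ∀ x, 0 ≤ ψ x) (hχ0 : ∀ x, 0 ≤ χ x)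
    (hφ1 : ∀ x, φ x ≤ 1) (hψ1 : ∀ x, ψ x ≤ 1) (hχ1 : ∀ x, χ x ≤ 1)
    (hφs : ∀ t < 1, ∃ x, t < φ x) (hψs : ∀ t < 1, ∃ x, t < ψ x) {a b : ℝ} (ha : 0 < a)
    (hb : 0 < b) (hab : a + b = 1) (h : ∀ x y, φ x ^ a * ψ y ^ b ≤ χ (a * x + b * y)) :
    ENNReal.ofReal a * (∫⁻ x, ENNReal.ofReal (φ x)) +
        ENNReal.ofReal b * (∫⁻ x, ENNReal.ofReal (ψ x)) ≤
      ∫⁻ x, ENNReal.ofReal (χ x) := by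
  rw [lintegral_ofReal_eq_lintegral_Ioo hφ hφ0 hφ1, lintegral_ofReal_eq_lintegral_Ioo hψ hψ0 hψ1,
    lintegral_ofReal_eq_lintegral_Ioo hχ hχ0 hχ1,
    ← lintegral_const_mul' _ _ ENNReal.ofReal_ne_top,
    ← lintegral_const_mul' _ _ ENNReal.ofReal_ne_top, ← lintegral_add_left]
  · refine setLIntegral_mono' measurableSet_Ioo fun t ht => ?_
    have e : ∀ (c : ℝ) (_ : 0 < c) (S : Set ℝ),
        ENNReal.ofReal c * volume S = volume (c • S) := by
      intro c hc S
      rw [Measure.addHaar_smul]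
      simp [abs_of_pos hc]
    rw [e a ha, e b hb]
    obtain ⟨x, hx⟩ := hφs t ht.2
    obtain ⟨y, hy⟩ := hψs t ht.2
    refine Real.volume_add_le_of_add_mem
      ((measurableSet_lt measurable_const hφ).const_smul₀ a)
      ((measurableSet_lt measurable_const hψ).const_smul₀ b)
      ⟨a • x, x, hx, rfl⟩ ⟨b • y, y, hy, rfl⟩ ?_
    rintro _ ⟨x, hx, rfl⟩ _ ⟨y, hy, rfl⟩
    have hx : t < φ x := hx
    have hy : t < ψ y := hy
    refine lt_of_lt_of_le ?_ (h x y)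
    calc t = t ^ a * t ^ b := by rw [← Real.rpow_add ht.1, hab, Real.rpow_one]
      _ < φ x ^ a * ψ y ^ b :=
        mul_lt_mul'' (Real.rpow_lt_rpow ht.1.le hx ha) (Real.rpow_lt_rpow ht.1.le hy hb)
          (Real.rpow_nonneg ht.1.le _) (Real.rpow_nonneg ht.1.le _)
  · refine Measurable.const_mul ?_ _
    exact (Antitone.measurable fun s t hst => measure_mono fun x hx => lt_of_le_of_lt hst hx)

theorem ENNReal.rpow_mul_rpow_le_add {a b : ℝ} (ha : 0 < a) (hb : 0 < b) (hab : a + b = 1)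
    (x y : ℝ≥0∞) : x ^ a * y ^ b ≤ ENNReal.ofReal a * x + ENNReal.ofReal b * y := by
  have ha' : ENNReal.ofReal a ≠ 0 := by simpa using ha
  have hb' : ENNReal.ofReal b ≠ 0 := by simpa using hb
  rcases eq_or_ne x ⊤ with rfl | hx
  · simp [ENNReal.mul_top ha']
  rcases eq_or_ne y ⊤ with rfl | hy
  · simp [ENNReal.mul_top hb']
  lift x to ℝ≥0 using hx
  lift y to ℝ≥0 using hy
  lift a to ℝ≥0 using ha.le
  lift b to ℝ≥0 using hb.le
  rw [← ENNReal.coe_rpow_of_nonneg _ ha.le, ← ENNReal.coe_rpow_of_nonneg _ hb.le,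
    ENNReal.ofReal_coe_nnreal, ENNReal.ofReal_coe_nnreal]
  exact_mod_cast NNReal.geom_mean_le_arith_mean2_weighted a b x y (by exact_mod_cast hab)

/-- Dividing by the suprema reduces to the normalized case, and arithmetic–geometric means turns the
additive bound into the multiplicative one. Capping `h` at `c` keeps the third function below 1. -/
theorem prekopaLeindler_real_bounded {f g h : ℝ → ℝ≥0∞} (hf : Measurable f) (hg : Measurable g)
    (hh : Measurable h) (hfb : ⨆ x, f x ≠ ⊤) (hgb : ⨆ x, g x ≠ ⊤) {a b : ℝ} (ha : 0 < a)
    (hb : 0 < b) (hab : a + b = 1) (H : ∀ x y, f x ^ a * g y ^ b ≤ h (a * x + b * y)) :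
    (∫⁻ x, f x) ^ a * (∫⁻ x, g x) ^ b ≤ ∫⁻ x, h x := by
  set F := ⨆ x, f x with hF
  set G := ⨆ x, g x with hG
  have hfF : ∀ x, f x ≤ F := le_iSup f
  have hgG : ∀ x, g x ≤ G := le_iSup g
  rcases eq_or_ne F 0 with hF0 | hF0
  · have : ∀ x, f x = 0 := fun x => le_antisymm (hF0 ▸ hfF x) zero_le
    simp [this, ENNReal.zero_rpow_of_pos ha]
  rcases eq_or_ne G 0 with hG0 | hG0
  · have : ∀ x, g x = 0 := fun x => le_antisymm (hG0 ▸ hgG x) zero_le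
    simp [this, ENNReal.zero_rpow_of_pos hb]
  set c := F ^ a * G ^ b with hc
  have hct : c ≠ ⊤ := ENNReal.mul_ne_top (ENNReal.rpow_ne_top_of_nonneg ha.le hfb)
    (ENNReal.rpow_ne_top_of_nonneg hb.le hgb)
  have hFa0 : F ^ a ≠ 0 := (ENNReal.rpow_pos (pos_iff_ne_zero.2 hF0) hfb).ne'
  have hGb0 : G ^ b ≠ 0 := (ENNReal.rpow_pos (pos_iff_ne_zero.2 hG0) hgb).ne'
  have hc0 : c ≠ 0 := mul_ne_zero hFa0 hGb0
  have hdiv1 : ∀ {u v : ℝ≥0∞}, u ≤ v → v ≠ 0 → v ≠ ⊤ → u / v ≤ 1 := fun huv h0 ht =>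
    ENNReal.div_le_of_le_mul (by simpa using huv)
  have hnt : ∀ {u v : ℝ≥0∞}, u ≤ v → v ≠ 0 → v ≠ ⊤ → u / v ≠ ⊤ := fun huv h0 ht =>
    ne_top_of_le_ne_top ENNReal.one_ne_top (hdiv1 huv h0 ht)
  have hto : ∀ {u v : ℝ≥0∞}, u ≤ v → v ≠ 0 → v ≠ ⊤ → (u / v).toReal ≤ 1 := fun huv h0 ht => by
    simpa using ENNReal.toReal_mono ENNReal.one_ne_top (hdiv1 huv h0 ht)
  have hsup : ∀ {k : ℝ → ℝ≥0∞}, (⨆ x, k x) ≠ 0 → (⨆ x, k x) ≠ ⊤ →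
      ∀ t < (1 : ℝ), ∃ x, t < (k x / ⨆ x, k x).toReal := by
    intro k h0 ht t ht1
    have hlt : ENNReal.ofReal t * (⨆ x, k x) < ⨆ x, k x := by
      calc ENNReal.ofReal t * (⨆ x, k x) < 1 * ⨆ x, k x :=
            (ENNReal.mul_lt_mul_iff_left h0 ht).2 (by simpa using ht1)
        _ = _ := one_mul _
    obtain ⟨x, hx⟩ := lt_iSup_iff.1 hlt
    refine ⟨x, ?_⟩
    have h1 : ENNReal.ofReal t < k x / ⨆ x, k x :=
      (ENNReal.lt_div_iff_mul_lt (Or.inl h0) (Or.inl ht)).2 hx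
    rcases le_or_gt 0 t with h2 | h2
    · rw [← ENNReal.toReal_ofReal h2]
      exact (ENNReal.toReal_lt_toReal ENNReal.ofReal_ne_top (hnt (le_iSup k x) h0 ht)).2 h1
    · exact h2.trans_le ENNReal.toReal_nonneg
  have hmain := prekopaLeindler_real_normalized (φ := fun x => (f x / F).toReal)
    (ψ := fun x => (g x / G).toReal) (χ := fun x => (min (h x) c / c).toReal)
    (hf.div_const F).ennreal_toReal (hg.div_const G).ennreal_toReal
    ((hh.min measurable_const).div_const c).ennreal_toReal
    (fun _ => ENNReal.toReal_nonneg) (fun _ => ENNReal.toReal_nonneg)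
    (fun _ => ENNReal.toReal_nonneg) (fun x => hto (hfF x) hF0 hfb) (fun x => hto (hgG x) hG0 hgb)
    (fun x => hto (min_le_right _ _) hc0 hct) (hsup hF0 hfb) (hsup hG0 hgb) ha hb hab (by
      intro x y
      rw [ENNReal.toReal_rpow, ENNReal.toReal_rpow, ← ENNReal.toReal_mul]
      refine ENNReal.toReal_mono (hnt (min_le_right _ _) hc0 hct) ?_
      rw [ENNReal.div_rpow_of_nonneg _ _ ha.le, ENNReal.div_rpow_of_nonneg _ _ hb.le]
      calc f x ^ a / F ^ a * (g y ^ b / G ^ b) = f x ^ a * g y ^ b / c := by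
            rw [hc, div_eq_mul_inv, div_eq_mul_inv, div_eq_mul_inv,
              ENNReal.mul_inv (Or.inl hFa0) (Or.inr hGb0)]
            ring
        _ ≤ min (h (a * x + b * y)) c / c := by
            refine ENNReal.div_le_div_right (le_min (H x y) ?_) c
            exact mul_le_mul' (ENNReal.rpow_le_rpow (hfF x) ha.le)
              (ENNReal.rpow_le_rpow (hgG y) hb.le))
  simp only [ENNReal.ofReal_toReal (hnt (hfF _) hF0 hfb),
    ENNReal.ofReal_toReal (hnt (hgG _) hG0 hgb),
    ENNReal.ofReal_toReal (hnt (min_le_right _ _) hc0 hct)] at hmain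
  simp only [div_eq_mul_inv] at hmain
  rw [lintegral_mul_const' _ _ (ENNReal.inv_ne_top.2 hF0),
    lintegral_mul_const' _ _ (ENNReal.inv_ne_top.2 hG0),
    lintegral_mul_const' _ _ (ENNReal.inv_ne_top.2 hc0)] at hmain
  have h2 := (ENNReal.rpow_mul_rpow_le_add ha hb hab _ _).trans hmain
  rw [ENNReal.mul_rpow_of_nonneg _ _ ha.le, ENNReal.mul_rpow_of_nonneg _ _ hb.le,
    ENNReal.inv_rpow, ENNReal.inv_rpow] at h2
  have h3 : (∫⁻ x, f x) ^ a * (∫⁻ x, g x) ^ b * c⁻¹ ≤ (∫⁻ x, min (h x) c) * c⁻¹ := by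
    refine le_trans (le_of_eq ?_) h2
    rw [hc, ENNReal.mul_inv (Or.inl hFa0) (Or.inr hGb0)]
    ring
  have h4 := (ENNReal.mul_le_mul_iff_left (ENNReal.inv_ne_zero.2 hct)
    (ENNReal.inv_ne_top.2 hc0)).1 h3
  exact h4.trans (lintegral_mono fun x => min_le_left _ _)

theorem prekopaLeindler_real {f g h : ℝ → ℝ≥0∞} (hf : Measurable f) (hg : Measurable g)
    (hh : Measurable h) {a b : ℝ} (ha : 0 < a) (hb : 0 < b) (hab : a + b = 1)
    (H : ∀ x y, f x ^ a * g y ^ b ≤ h (a * x + b * y)) :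
    (∫⁻ x, f x) ^ a * (∫⁻ x, g x) ^ b ≤ ∫⁻ x, h x := by
  rcases eq_or_ne (∫⁻ x, f x) 0 with hf0 | hf0
  · simp [hf0, ENNReal.zero_rpow_of_pos ha]
  rcases eq_or_ne (∫⁻ x, g x) 0 with hg0 | hg0
  · simp [hg0, ENNReal.zero_rpow_of_pos hb]
  have htr : ∀ {k : ℝ → ℝ≥0∞}, Measurable k →
      Tendsto (fun N : ℕ => ∫⁻ x, min (k x) N) atTop (𝓝 (∫⁻ x, k x)) := by
    intro k hk
    refine lintegral_tendsto_of_tendsto_of_monotone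
      (fun N => (hk.min measurable_const).aemeasurable) (Eventually.of_forall fun x => ?_)
      (Eventually.of_forall fun x => ?_)
    · intro M N hMN
      exact min_le_min le_rfl (by exact_mod_cast hMN)
    · have := (tendsto_const_nhds (x := k x)).min ENNReal.tendsto_nat_nhds_top
      rwa [min_eq_left le_top] at this
  have hbd : ∀ (k : ℝ → ℝ≥0∞) (N : ℕ), ⨆ x, min (k x) (N : ℝ≥0∞) ≠ ⊤ := fun k N =>
    ne_top_of_le_ne_top (ENNReal.natCast_ne_top N) (iSup_le fun x => min_le_right _ _)
  have hpos : ∀ {u : ℝ≥0∞} {r : ℝ}, u ≠ 0 → 0 < r → u ^ r ≠ 0 := by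
    intro u r hu hr h0
    rcases ENNReal.rpow_eq_zero_iff.1 h0 with h1 | h1
    · exact hu h1.1
    · linarith [h1.2]
  -- Truncation at `N` and monotone convergence; nonzero integrals make the product in `ℝ≥0∞`
  -- continuous at the limit.
  refine le_of_tendsto (ENNReal.Tendsto.mul
    ((ENNReal.continuous_rpow_const.tendsto _).comp (htr hf)) (Or.inl (hpos hf0 ha))
    ((ENNReal.continuous_rpow_const.tendsto _).comp (htr hg)) (Or.inl (hpos hg0 hb)))
    (Eventually.of_forall fun N => ?_)
  refine prekopaLeindler_real_bounded (hf.min measurable_const) (hg.min measurable_const) hh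
    (hbd f N) (hbd g N) ha hb hab fun x y => le_trans ?_ (H x y)
  exact mul_le_mul' (ENNReal.rpow_le_rpow (min_le_left _ _) ha.le)
    (ENNReal.rpow_le_rpow (min_le_left _ _) hb.le)

/-- The **Prékopa–Leindler inequality**. -/
theorem prekopaLeindler {n : ℕ} {f g h : (Fin n → ℝ) → ℝ≥0∞} (hf : Measurable f)
    (hg : Measurable g) (hh : Measurable h) {a b : ℝ} (ha : 0 < a) (hb : 0 < b) (hab : a + b = 1)
    (H : ∀ x y, f x ^ a * g y ^ b ≤ h (a • x + b • y)) :
    (∫⁻ x, f x) ^ a * (∫⁻ x, g x) ^ b ≤ ∫⁻ x, h x := by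
  induction n with
  | zero =>
    have hv : (volume : Measure (Fin 0 → ℝ)) univ = 1 := by
      rw [volume_pi, Measure.pi_of_empty _ default]
      simp
    rw [lintegral_unique, lintegral_unique, lintegral_unique, hv, mul_one, mul_one, mul_one]
    convert H default default
  | succ n ih =>
    have hvp := (volume_preserving_piFinSuccAbove (fun _ : Fin (n + 1) => ℝ) 0).symm
    set e := (MeasurableEquiv.piFinSuccAbove (fun _ : Fin (n + 1) => ℝ) 0).symm with he
    have hint : ∀ {k : (Fin (n + 1) → ℝ) → ℝ≥0∞}, Measurable k →
        ∫⁻ x, k x = ∫⁻ t : ℝ, ∫⁻ y : Fin n → ℝ, k (e (t, y)) := by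
      intro k hk
      rw [← hvp.lintegral_comp hk, Measure.volume_eq_prod,
        lintegral_prod (fun z => k (e z)) (hk.comp e.measurable).aemeasurable]
    have hmeas : ∀ {k : (Fin (n + 1) → ℝ) → ℝ≥0∞}, Measurable k →
        Measurable fun t : ℝ => ∫⁻ y : Fin n → ℝ, k (e (t, y)) := fun hk =>
      (hk.comp e.measurable).lintegral_prod_right'
    rw [hint hf, hint hg, hint hh]
    refine prekopaLeindler_real (hmeas hf) (hmeas hg) (hmeas hh) ha hb hab fun s t => ?_
    refine ih (hf.comp (e.measurable.comp measurable_prodMk_left))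
      (hg.comp (e.measurable.comp measurable_prodMk_left))
      (hh.comp (e.measurable.comp measurable_prodMk_left)) fun x y => ?_
    convert H (e (s, x)) (e (t, y)) using 2
    ext i
    refine Fin.cases ?_ (fun j => ?_) i <;> simp [he]

/-- The multiplicative form of the **Brunn–Minkowski inequality**. -/
theorem volume_rpow_mul_volume_rpow_le {n : ℕ} {A B : Set (EuclideanSpace ℝ (Fin n))}
    (hA : IsCompact A) (hB : IsCompact B) {a b : ℝ} (ha : 0 < a) (hb : 0 < b) (hab : a + b = 1) :
    volume A ^ a * volume B ^ b ≤ volume (a • A + b • B) := by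
  have hind : ∀ {S : Set (EuclideanSpace ℝ (Fin n))}, IsCompact S →
      Measurable (S.indicator (1 : EuclideanSpace ℝ (Fin n) → ℝ≥0∞)) := fun hS =>
    measurable_one.indicator hS.measurableSet
  have hvp := PiLp.volume_preserving_toLp (Fin n)
  have hint : ∀ {S : Set (EuclideanSpace ℝ (Fin n))}, IsCompact S →
      ∫⁻ x, S.indicator (1 : EuclideanSpace ℝ (Fin n) → ℝ≥0∞) (WithLp.toLp 2 x) = volume S := by
    intro S hS
    rw [hvp.lintegral_comp (hind hS), lintegral_indicator_one hS.measurableSet]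
  have hC : IsCompact (a • A + b • B) := (hA.smul a).add (hB.smul b)
  rw [← hint hA, ← hint hB, ← hint hC]
  refine prekopaLeindler ((hind hA).comp hvp.measurable) ((hind hB).comp hvp.measurable)
    ((hind hC).comp hvp.measurable) ha hb hab fun x y => ?_
  by_cases hx : WithLp.toLp 2 x ∈ A
  · by_cases hy : WithLp.toLp 2 y ∈ B
    · have : a • WithLp.toLp 2 x + b • WithLp.toLp 2 y ∈ a • A + b • B :=
        ⟨a • WithLp.toLp 2 x, smul_mem_smul_set hx, b • WithLp.toLp 2 y, smul_mem_smul_set hy, rfl⟩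
      simp [hx, hy, this]
    · simp [hy, ENNReal.zero_rpow_of_pos hb]
  · simp [hx, ENNReal.zero_rpow_of_pos ha]

end PrekopaLeindler

/-! ### The lower bound for `c_n`. -/

section BallConstant

/-- Log-convexity of `Γ` at the midpoint of `y` and `y + 1`. -/
theorem Real.log_Gamma_add_half_le {y : ℝ} (hy : 0 < y) :
    Real.log (Real.Gamma (y + 1 / 2)) ≤ Real.log (Real.Gamma y) + 1 / 2 * Real.log y := by
  have h := Real.convexOn_log_Gamma.2 (mem_Ioi.2 hy) (mem_Ioi.2 (by linarith : 0 < y + 1))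
    (by norm_num : (0 : ℝ) ≤ 1 / 2) (by norm_num : (0 : ℝ) ≤ 1 / 2) (by norm_num)
  have e1 : (1 / 2 : ℝ) • y + (1 / 2 : ℝ) • (y + 1) = y + 1 / 2 := by
    simp only [smul_eq_mul]; ring
  rw [e1] at h
  simp only [Function.comp_apply, smul_eq_mul] at h
  rw [Real.Gamma_add_one hy.ne', Real.log_mul hy.ne' (Real.Gamma_pos_of_pos hy).ne'] at h
  linarith

/-- With `x = (n + 1) / 2`, steps of two in `n` are steps of one in `x`, so the recurrence of `Γ`
applies. The case `x = 1/2` amounts to `π / 4 > 1 / e`. -/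
theorem Real.mul_log_sub_lt_log_Gamma (n : ℕ) :
    ((n + 1 : ℕ) : ℝ) / 2 * Real.log (((n + 1 : ℕ) : ℝ) / 2 + 1 / 2) - ((n + 1 : ℕ) : ℝ) / 2 <
      Real.log (Real.Gamma (((n + 1 : ℕ) : ℝ) / 2 + 1)) := by
  induction n using Nat.twoStepInduction with
  | zero =>
    have h1 : Real.Gamma (1 / 2 + 1) = √Real.pi / 2 := by
      rw [Real.Gamma_add_one (by norm_num), Real.Gamma_one_half_eq]; ring
    have hpi : 0 < √Real.pi := Real.sqrt_pos.2 Real.pi_pos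
    have h2 : Real.log (√Real.pi / 2) = 1 / 2 * Real.log (Real.pi / 4) := by
      have : Real.pi / 4 = (√Real.pi / 2) ^ 2 := by
        rw [div_pow, Real.sq_sqrt Real.pi_pos.le]; norm_num
      rw [this, Real.log_pow]
      push_cast
      ring
    have h3 : -1 < Real.log (Real.pi / 4) := by
      rw [Real.lt_log_iff_exp_lt (by positivity), Real.exp_neg, inv_lt_comm₀ (Real.exp_pos _)
        (by positivity), inv_div]
      have := Real.exp_one_gt_d9
      rw [div_lt_iff₀ Real.pi_pos]
      nlinarith [Real.pi_gt_three]
    norm_num only [Nat.cast_one, zero_add] at *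
    rw [h1, h2, Real.log_one]
    linarith
  | one =>
    have h1 := Real.log_le_sub_one_of_pos (show (0 : ℝ) < 3 / 2 by norm_num)
    have h2 : Real.Gamma (((1 + 1 : ℕ) : ℝ) / 2 + 1) = 1 := by
      norm_num [Real.Gamma_two]
    rw [h2, Real.log_one]
    norm_num
    norm_num at h1
    linarith
  | more n ih _ =>
    set x : ℝ := ((n + 1 : ℕ) : ℝ) / 2 with hx
    have hx0 : 0 < x := by rw [hx]; positivity
    have e1 : ((n + 1 + 1 + 1 : ℕ) : ℝ) / 2 = x + 1 := by rw [hx]; push_cast; ring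
    rw [e1, Real.Gamma_add_one (by positivity), Real.log_mul (by positivity)
      (Real.Gamma_pos_of_pos (by positivity)).ne']
    have h1 : Real.log ((x + 1 + 1 / 2) / (x + 1 / 2)) ≤ (x + 1 + 1 / 2) / (x + 1 / 2) - 1 :=
      Real.log_le_sub_one_of_pos (by positivity)
    have h2 : Real.log ((x + 1 + 1 / 2) / (x + 1)) ≤ (x + 1 + 1 / 2) / (x + 1) - 1 :=
      Real.log_le_sub_one_of_pos (by positivity)
    rw [Real.log_div (by positivity) (by positivity)] at h1 h2
    have h3 : x * ((x + 1 + 1 / 2) / (x + 1 / 2) - 1) + ((x + 1 + 1 / 2) / (x + 1) - 1) ≤ 1 := by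
      have : x * ((x + 1 + 1 / 2) / (x + 1 / 2) - 1) + ((x + 1 + 1 / 2) / (x + 1) - 1) =
          1 - 1 / (2 * (x + 1) * (2 * x + 1)) := by
        field_simp
        ring
      rw [this]
      have : 0 < 1 / (2 * (x + 1) * (2 * x + 1)) := by positivity
      linarith
    have h4 := mul_le_mul_of_nonneg_left h1 hx0.le
    nlinarith

theorem bodyVolume_unitBall {n : ℕ} (hn : 1 ≤ n) :
    bodyVolume (unitBall n) = √Real.pi ^ n / Real.Gamma ((n : ℝ) / 2 + 1) := by
  have : Nonempty (Fin n) := Fin.pos_iff_nonempty.1 hn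
  have hG : 0 < Real.Gamma ((n : ℝ) / 2 + 1) := Real.Gamma_pos_of_pos (by positivity)
  have : (volume : Measure (EuclideanSpace ℝ (Fin n))) (closedBall 0 1) = _ :=
    EuclideanSpace.volume_closedBall (Fin n) 0 1
  change ((volume : Measure (EuclideanSpace ℝ (Fin n))) (closedBall 0 1)).toReal = _
  rw [this, ENNReal.ofReal_one, one_pow, one_mul, Fintype.card_fin,
    ENNReal.toReal_ofReal (by positivity)]

theorem inv_sqrt_exp_lt_ballConstant {n : ℕ} (hn : 2 ≤ n) :
    1 / Real.sqrt (Real.exp 1) < ballConstant n := by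
  obtain ⟨m, rfl⟩ : ∃ m, n = m + 1 := ⟨n - 1, by omega⟩
  have hm : 1 ≤ m := by omega
  have hpi : 0 < √Real.pi := Real.sqrt_pos.2 Real.pi_pos
  have hG1 : 0 < Real.Gamma (((m + 1 : ℕ) : ℝ) / 2 + 1) := Real.Gamma_pos_of_pos (by positivity)
  have hG2 : 0 < Real.Gamma ((m : ℝ) / 2 + 1) := Real.Gamma_pos_of_pos (by positivity)
  have h1 := Real.mul_log_sub_lt_log_Gamma m
  have h2 := Real.log_Gamma_add_half_le (y := (m : ℝ) / 2 + 1) (by positivity)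
  have e0 : (m : ℝ) / 2 + 1 + 1 / 2 = ((m + 1 : ℕ) : ℝ) / 2 + 1 := by push_cast; ring
  have e1 : ((m + 1 : ℕ) : ℝ) / 2 + 1 / 2 = (m : ℝ) / 2 + 1 := by push_cast; ring
  rw [e0] at h2
  rw [e1] at h1
  have hpos1 : 0 < bodyVolume (unitBall (m + 1)) := by
    rw [bodyVolume_unitBall (by omega)]; positivity
  have hpos2 : 0 < bodyVolume (unitBall m) := by
    rw [bodyVolume_unitBall hm]; positivity
  rw [ballConstant, Nat.add_sub_cancel]
  have hlhs : 1 / √(Real.exp 1) = Real.exp (-(1 / 2)) := by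
    rw [← Real.exp_half, Real.exp_neg, one_div]
  rw [hlhs, ← Real.lt_log_iff_exp_lt (by positivity), Real.log_div (by positivity) hpos2.ne',
    Real.log_rpow hpos1, bodyVolume_unitBall (by omega), bodyVolume_unitBall hm,
    Real.log_div (by positivity) hG1.ne', Real.log_div (by positivity) hG2.ne', Real.log_pow,
    Real.log_pow]
  set A := Real.log (Real.Gamma (((m + 1 : ℕ) : ℝ) / 2 + 1))
  set B := Real.log (Real.Gamma ((m : ℝ) / 2 + 1))
  set P := Real.log √Real.pi
  set Q := Real.log ((m : ℝ) / 2 + 1)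
  have hN : (0 : ℝ) < ((m + 1 : ℕ) : ℝ) := by positivity
  -- The powers of `π` cancel. The two `Γ` estimates give `B - A ≥ -Q / 2` and `A / (m + 1) > (Q -
  -- 1) / 2`, which add up to more than `-1/2`.
  have e2 : (((m + 1 : ℕ) : ℝ) - 1) / ((m + 1 : ℕ) : ℝ) * (((m + 1 : ℕ) : ℝ) * P - A) - (m * P - B) =
      B - A + A / ((m + 1 : ℕ) : ℝ) := by
    field_simp
    push_cast
    ring
  rw [e2]
  have h3 : (Q - 1) / 2 < A / ((m + 1 : ℕ) : ℝ) := by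
    rw [lt_div_iff₀ hN]
    linarith
  linarith

end BallConstant

/-! ### Projections and surface area of the ball. -/

section Ball

variable {E : Type*} [NormedAddCommGroup E] [InnerProductSpace ℝ E]
  [FiniteDimensional ℝ E] [MeasurableSpace E] [BorelSpace E]

theorem bodyVolume_unitBall_pos (k : ℕ) : 0 < bodyVolume (unitBall k) :=
  ENNReal.toReal_pos (measure_closedBall_pos volume 0 one_pos).ne'
    (isCompact_closedBall 0 1).measure_lt_top.ne

theorem volume_real_closedBall_one :
    volume.real (closedBall (0 : E) 1) = bodyVolume (unitBall (finrank ℝ E)) := by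
  have h := (stdOrthonormalBasis ℝ E).measurePreserving_repr_symm
  have h2 := h.measure_preimage (s := closedBall (0 : E) 1)
    isClosed_closedBall.measurableSet.nullMeasurableSet
  rw [measureReal_def, ← h2, LinearIsometryEquiv.preimage_closedBall]
  simp only [map_zero]
  rfl

theorem volume_real_closedBall_of_finrank {k : ℕ} (hk : finrank ℝ E = k) :
    volume.real (closedBall (0 : E) 1) = bodyVolume (unitBall k) := by
  rw [volume_real_closedBall_one, hk]

theorem isCentredBody_closedBall {r : ℝ} (hr : 0 < r) : IsCentredBody (closedBall (0 : E) r) :=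
  ⟨isCompact_closedBall 0 r, convex_closedBall 0 r, closedBall_mem_nhds 0 hr⟩

theorem perpProj_image_closedBall (a : E) (r : ℝ) :
    perpProj a '' closedBall 0 r = closedBall 0 r := by
  ext y
  simp only [Set.mem_image, mem_closedBall_zero_iff]
  constructor
  · rintro ⟨x, hx, rfl⟩
    exact (Submodule.norm_orthogonalProjectionOnto_apply_le _ x).trans hx
  · intro hy
    exact ⟨y, hy, Submodule.orthogonalProjectionOnto_mem_subspace_eq_self y⟩

theorem sweep_closedBall_one (x : E) :
    sweep (closedBall (0 : E) 1) x = ‖x‖ * bodyVolume (unitBall (finrank ℝ E - 1)) := by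
  rcases eq_or_ne x 0 with rfl | hx
  · simp [sweep_zero]
  · have h : projVolume (Submodule.span ℝ {x})ᗮ (closedBall (0 : E) 1) =
        bodyVolume (unitBall (finrank ℝ E - 1)) := by
      rw [← volume_real_closedBall_of_finrank (finrank_perp hx), ← perpProj_image_closedBall]
      rfl
    rw [sweep_eq (isCompact_closedBall 0 1) (convex_closedBall 0 1), h]

theorem exists_isNearUnitBall [Nontrivial E] {η : ℝ} (hη : 1 < η) :
    ∃ l : List E, IsNearUnitBall η l := by
  obtain ⟨l, hl⟩ := (isCentredBody_closedBall (E := E) one_pos).exists_zonotopeSupport hη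
  have hκ := bodyVolume_unitBall_pos (finrank ℝ E - 1)
  set κ := bodyVolume (unitBall (finrank ℝ E - 1))
  refine ⟨l.map (κ⁻¹ • ·), fun x => ?_⟩
  have h := hl x
  rw [sweep_closedBall_one] at h
  rw [zonotopeSupport_map_smul (by positivity)]
  constructor
  · rw [inv_mul_eq_div, le_div_iff₀ hκ]
    exact h.1
  · rw [inv_mul_eq_div, div_le_iff₀ hκ]
    linarith [h.2]

theorem zonotope_subset_closedBall [Nontrivial E] {η : ℝ} {l : List E} (h : IsNearUnitBall η l) :
    closedBall (0 : E) 1 ⊆ zonotope l ∧ zonotope l ⊆ closedBall 0 η := by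
  constructor
  · refine subset_of_forall_inner_le (convex_zonotope l) (isCompact_zonotope l) fun x y hy => ?_
    obtain ⟨z, hz, hxz⟩ := exists_mem_zonotope_inner_eq l x
    refine ⟨z, hz, ?_⟩
    rw [hxz]
    refine le_trans ?_ (h x).1
    refine (real_inner_le_norm x y).trans (mul_le_of_le_one_right (norm_nonneg x) ?_)
    simpa using hy
  · intro y hy
    rw [mem_closedBall_zero_iff]
    have h1 := (inner_le_zonotopeSupport y hy).trans (h y).2
    rw [real_inner_self_eq_norm_sq] at h1
    rcases (norm_nonneg y).eq_or_lt with h2 | h2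
    · obtain ⟨x, hx⟩ := exists_ne (0 : E)
      have h3 := (h x).1.trans (h x).2
      rw [← h2]
      exact zero_le_one.trans (le_of_mul_le_mul_right (by simpa using h3) (norm_pos_iff.2 hx))
    · exact le_of_mul_le_mul_right (by linarith) h2

/-- The surface area of the unit ball is `d` times its volume. -/
theorem surfaceArea_closedBall_one [Nontrivial E]
    (h : ∀ η : ℝ, 1 < η → ∃ l : List E, IsNearUnitBall η l) :
    surfaceArea (closedBall (0 : E) 1) = finrank ℝ E * bodyVolume (unitBall (finrank ℝ E)) := by
  set d := finrank ℝ E with hd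
  set κ := bodyVolume (unitBall d) with hκ
  have hκ0 : 0 < κ := bodyVolume_unitBall_pos d
  have hB := isCentredBody_closedBall (E := E) one_pos
  have hvol : volume.real (closedBall (0 : E) 1) = κ := volume_real_closedBall_one
  have hvol' : ∀ r : ℝ, 0 ≤ r → volume.real (closedBall (0 : E) r) = r ^ d * κ := by
    intro r hr
    rw [← hvol, ← volume_real_smul hr, smul_unitClosedBall_of_nonneg hr]
  -- `W` is the sum of the sweeps of the ball along a nearly round zonotope. Cauchy's formula
  -- compares it with the surface area, and the growth of the volume of `B + s • Z` compares it with
  -- `d * κ`.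
  have key : ∀ η : ℝ, 1 < η → ∃ W : ℝ, surfaceArea (closedBall (0 : E) 1) ≤ W ∧
      W ≤ η * surfaceArea (closedBall (0 : E) 1) ∧ d * κ ≤ W ∧ W ≤ d * η * κ := by
    intro η hη
    have hη0 : (0 : ℝ) < η := by linarith
    obtain ⟨l, hl⟩ := h η hη
    obtain ⟨h1, h2⟩ := hl.surfaceArea_le hB
    obtain ⟨h3, h4⟩ := zonotope_subset_closedBall hl
    refine ⟨_, h1, h2, ?_, ?_⟩
    · have hs : ∀ s : ℝ, 0 < s →
          d * κ ≤ (1 + s * η) ^ (d - 1) * (l.map (sweep (closedBall (0 : E) 1))).sum := by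
        intro s hs
        have hsη : 0 < 1 + s * η := by positivity
        have h5 := (volume_add_zonotope (l.map (s • ·)) hB.isCompact hB.convex).2
        rw [zonotope_smul, hvol, List.map_map] at h5
        have hlow : (1 + s) ^ d * κ ≤ volume.real (closedBall (0 : E) 1 + s • zonotope l) := by
          rw [← hvol' _ (by linarith)]
          refine measureReal_mono ?_
            (hB.isCompact.add ((isCompact_zonotope l).smul s)).measure_lt_top.ne
          rw [← smul_unitClosedBall_of_nonneg (by linarith : 0 ≤ 1 + s),
            smul_add_smul_of_convex hB.convex hs.le]
          exact Set.add_subset_add_left (smul_set_mono h3)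
        have hup : closedBall (0 : E) 1 + s • zonotope l ⊆ (1 + s * η) • closedBall (0 : E) 1 := by
          rw [smul_add_smul_of_convex hB.convex (by positivity), mul_smul,
            smul_unitClosedBall_of_nonneg hη0.le]
          exact Set.add_subset_add_left (smul_set_mono h4)
        have h6 : (l.map (sweep (closedBall (0 : E) 1 + s • zonotope l) ∘ (s • ·))).sum ≤
            s * ((1 + s * η) ^ (d - 1) * (l.map (sweep (closedBall (0 : E) 1))).sum) := by
          rw [← List.sum_map_mul_left, ← List.sum_map_mul_left]
          refine List.sum_le_sum fun a _ => ?_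
          have hc := hB.isCompact.add ((isCompact_zonotope l).smul s)
          have hconv := hB.convex.add ((convex_zonotope l).smul s)
          rw [Function.comp_apply, sweep_smul_right hc hconv hs.le, hd,
            ← sweep_smul_left hB.isCompact hB.convex hsη]
          refine mul_le_mul_of_nonneg_left ?_ hs.le
          exact sweep_mono hc hconv (hB.isCompact.smul _) (hB.convex.smul _) hup a
        have h7 := one_add_mul_le_pow (by linarith : (-2 : ℝ) ≤ s) d
        have h8 := mul_le_mul_of_nonneg_right h7 hκ0.le
        refine le_of_mul_le_mul_left ?_ hs
        linarith
      have := le_of_forall_pos_le_continuous (f := fun s : ℝ =>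
        (1 + s * η) ^ (d - 1) * (l.map (sweep (closedBall (0 : E) 1))).sum) (by fun_prop) hs
      simpa using this
    · have hs : ∀ s : ℝ, 0 < s →
          (l.map (sweep (closedBall (0 : E) 1))).sum ≤ d * η * (1 + s * η) ^ d * κ := by
        intro s hs
        have hsη : 0 < 1 + s * η := by positivity
        have h5 := (volume_add_zonotope (l.map (s • ·)) hB.isCompact hB.convex).1
        rw [zonotope_smul, hvol, List.map_map] at h5
        have hup : volume.real (closedBall (0 : E) 1 + s • zonotope l) ≤ (1 + s * η) ^ d * κ := by
          rw [← hvol' _ hsη.le]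
          refine measureReal_mono ?_ (isCompact_closedBall _ _).measure_lt_top.ne
          rw [← smul_unitClosedBall_of_nonneg hsη.le,
            smul_add_smul_of_convex hB.convex (by positivity), mul_smul,
            smul_unitClosedBall_of_nonneg hη0.le]
          exact Set.add_subset_add_left (smul_set_mono h4)
        have h6 : (l.map (sweep (closedBall (0 : E) 1) ∘ (s • ·))).sum =
            s * (l.map (sweep (closedBall (0 : E) 1))).sum := by
          rw [← List.sum_map_mul_left]
          congr 2
          ext a
          rw [Function.comp_apply, sweep_smul_right hB.isCompact hB.convex hs.le]
        have h7 := mul_le_mul_of_nonneg_right (one_add_pow_sub_one_le d (by positivity : 0 ≤ s * η))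
          hκ0.le
        refine le_of_mul_le_mul_left ?_ hs
        rw [← h6]
        linarith
      have := le_of_forall_pos_le_continuous (f := fun s : ℝ => d * η * (1 + s * η) ^ d * κ)
        (by fun_prop) hs
      simpa using this
  apply le_antisymm
  · have := le_of_forall_pos_le_continuous (f := fun η : ℝ => d * η * κ) (by fun_prop)
      fun η hη => by
        obtain ⟨W, h1, -, -, h4⟩ := key η hη
        exact h1.trans h4
    simpa using this
  · have := le_of_forall_pos_le_continuous
      (f := fun η : ℝ => η * surfaceArea (closedBall (0 : E) 1)) (by fun_prop)
      fun η hη => by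
        obtain ⟨W, -, h2, h3, -⟩ := key η hη
        exact h3.trans h2
    simpa using this

theorem IsCentredBody.image_perpProj {A : Set E} (hA : IsCentredBody A) (a : E) :
    IsCentredBody (perpProj a '' A) where
  isCompact := hA.isCompact.image (perpProj a).continuous
  convex := hA.convex.is_linear_image (perpProj a).toLinearMap.isLinear
  mem_nhds := by
    have hsurj : Function.Surjective (perpProj a) := fun y =>
      ⟨y, Submodule.orthogonalProjectionOnto_mem_subspace_eq_self y⟩
    have := ((perpProj a).isOpenMap hsurj).image_mem_nhds hA.mem_nhds
    rwa [map_zero] at this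

theorem nontrivial_perp (hd : 2 ≤ finrank ℝ E) {a : E} (ha : a ≠ 0) :
    Nontrivial (Submodule.span ℝ {a})ᗮ := by
  apply nontrivial_of_finrank_pos (R := ℝ)
  rw [finrank_perp ha]
  omega

theorem surfaceArea_perp_closedBall (hd : 2 ≤ finrank ℝ E) {a : E} (ha : a ≠ 0) :
    surfaceArea (perpProj a '' closedBall (0 : E) 1) =
      (finrank ℝ E - 1 : ℕ) * bodyVolume (unitBall (finrank ℝ E - 1)) := by
  have := nontrivial_perp hd ha
  have : Nontrivial E := nontrivial_of_ne a 0 ha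
  rw [perpProj_image_closedBall, surfaceArea_closedBall_one, finrank_perp ha]
  intro η hη
  obtain ⟨l, hl⟩ := exists_isNearUnitBall (E := E) hη
  exact ⟨_, hl.map_perpProj a⟩

end Ball

/-! ### The two inequalities for zonotopes, and projection bodies. -/

section ProjectionBody

/-- Minkowski's first inequality for `Z` and the ball of the same volume: both sides compare with
the derivative of the volume of `ρ • U + s • Z` at `s = 0`. -/
theorem finrank_mul_volume_le_sum_norm {n : ℕ} (hn : 2 ≤ n) {l : List (EuclideanSpace ℝ (Fin n))}
    (hV : 0 < volume.real (zonotope l)) {ρ : ℝ} (hρ : 0 < ρ)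
    (h : ρ ^ n * bodyVolume (unitBall n) = volume.real (zonotope l)) :
    n * volume.real (zonotope l) ≤
      ρ ^ (n - 1) * bodyVolume (unitBall (n - 1)) * (l.map fun a => ‖a‖).sum := by
  have : Nontrivial (EuclideanSpace ℝ (Fin n)) :=
    nontrivial_of_finrank_pos (R := ℝ) (by rw [finrank_euclideanSpace_fin]; omega)
  have hd : finrank ℝ (EuclideanSpace ℝ (Fin n)) = n := finrank_euclideanSpace_fin
  set Z := zonotope l with hZ
  set V := volume.real Z with hVdef
  set κ' := bodyVolume (unitBall (n - 1))
  have hZc : IsCompact Z := isCompact_zonotope l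
  have hZconv : Convex ℝ Z := convex_zonotope l
  set U : Set (EuclideanSpace ℝ (Fin n)) := closedBall 0 1 with hU
  have hUB : IsCentredBody U := isCentredBody_closedBall one_pos
  have hBB := hUB.smul hρ
  have hBvol : volume.real (ρ • U) = V := by rw [volume_real_smul hρ.le, hd]; exact h
  obtain ⟨R, hR0, hR⟩ := hZc.isBounded.subset_closedBall_lt 0 0
  have key : ∀ s : ℝ, 0 < s →
      n * V ≤ (ρ + s * R) ^ (n - 1) * κ' * (l.map fun a => ‖a‖).sum := by
    intro s hs
    have h1s : 0 < 1 + s := by linarith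
    have hρR : 0 < ρ + s * R := by positivity
    have hc := hBB.isCompact.add (hZc.smul s)
    have hconv := hBB.convex.add (hZconv.smul s)
    have hlow : (1 + s) ^ n * V ≤ volume.real (ρ • U + s • Z) := by
      -- Because the two volumes agree, the multiplicative form already gives the sharp bound for
      -- the normalized sum.
      have hBM := volume_rpow_mul_volume_rpow_le hBB.isCompact hZc (a := 1 / (1 + s))
        (b := s / (1 + s)) (by positivity) (by positivity) (by field_simp)
      have e1 : volume (ρ • U) = ENNReal.ofReal V := by
        rw [← hBvol, measureReal_def, ENNReal.ofReal_toReal hBB.isCompact.measure_lt_top.ne]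
      have e2 : volume Z = ENNReal.ofReal V := by
        rw [hVdef, measureReal_def, ENNReal.ofReal_toReal hZc.measure_lt_top.ne]
      have e3 : ENNReal.ofReal V ≠ 0 := by simpa using hV
      rw [e1, e2, ← ENNReal.rpow_add _ _ e3 ENNReal.ofReal_ne_top] at hBM
      have e4 : 1 / (1 + s) + s / (1 + s) = 1 := by field_simp
      rw [e4, ENNReal.rpow_one] at hBM
      have hc2 : IsCompact ((1 / (1 + s)) • (ρ • U) + (s / (1 + s)) • Z) :=
        (hBB.isCompact.smul _).add (hZc.smul _)
      have e5 : V ≤ volume.real ((1 / (1 + s)) • (ρ • U) + (s / (1 + s)) • Z) :=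
        (ENNReal.ofReal_le_iff_le_toReal hc2.measure_lt_top.ne).1 hBM
      have e6 : ρ • U + s • Z = (1 + s) • ((1 / (1 + s)) • (ρ • U) + (s / (1 + s)) • Z) := by
        rw [smul_add, smul_smul, smul_smul, mul_one_div_cancel h1s.ne', one_mul, smul_smul,
          mul_div_cancel₀ _ h1s.ne']
      rw [e6, volume_real_smul h1s.le, hd]
      exact mul_le_mul_of_nonneg_left e5 (by positivity)
    have hup : ρ • U + s • Z ⊆ (ρ + s * R) • U := by
      rw [hUB.convex.add_smul hρ.le (by positivity), mul_smul, hU,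
        smul_unitClosedBall_of_nonneg hR0.le]
      exact Set.add_subset_add_left (smul_set_mono hR)
    have h5 := (volume_add_zonotope (l.map (s • ·)) hBB.isCompact hBB.convex).2
    rw [zonotope_smul, hBvol, List.map_map] at h5
    have h6 : (l.map (sweep (ρ • U + s • Z) ∘ (s • ·))).sum ≤
        s * ((ρ + s * R) ^ (n - 1) * κ' * (l.map fun a => ‖a‖).sum) := by
      rw [← List.sum_map_mul_left, ← List.sum_map_mul_left]
      refine List.sum_le_sum fun a _ => ?_
      rw [Function.comp_apply, sweep_smul_right hc hconv hs.le]
      refine mul_le_mul_of_nonneg_left ?_ hs.le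
      refine (sweep_mono hc hconv (hUB.isCompact.smul _) (hUB.convex.smul _) hup a).trans ?_
      rw [sweep_smul_left hUB.isCompact hUB.convex hρR, sweep_closedBall_one, hd]
      exact le_of_eq (by ring)
    have h8 := mul_le_mul_of_nonneg_right (one_add_mul_le_pow (by linarith : (-2 : ℝ) ≤ s) n) hV.le
    refine le_of_mul_le_mul_left ?_ hs
    linarith
  have := le_of_forall_pos_le_continuous (f := fun s : ℝ =>
    (ρ + s * R) ^ (n - 1) * κ' * (l.map fun a => ‖a‖).sum) (by fun_prop) key
  simpa using this

/-- Among zonotopes with a given total length of generators, the ball has the largest volume. -/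
theorem ballConstant_mul_volume_rpow_le_sum_norm {n : ℕ} (hn : 2 ≤ n)
    {l : List (EuclideanSpace ℝ (Fin n))} (hV : 0 < volume.real (zonotope l)) :
    n * ballConstant n * volume.real (zonotope l) ^ (1 / (n : ℝ)) ≤ (l.map fun a => ‖a‖).sum := by
  set V := volume.real (zonotope l)
  set S := (l.map fun a => ‖a‖).sum
  have hκ := bodyVolume_unitBall_pos n
  have hκ' := bodyVolume_unitBall_pos (n - 1)
  rw [ballConstant]
  set κ := bodyVolume (unitBall n)
  set κ' := bodyVolume (unitBall (n - 1))
  have hn0 : (n : ℝ) ≠ 0 := by positivity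
  set v := V ^ (1 / (n : ℝ)) with hv
  set k := κ ^ (1 / (n : ℝ)) with hk
  have hv0 : 0 < v := Real.rpow_pos_of_pos hV _
  have hk0 : 0 < k := Real.rpow_pos_of_pos hκ _
  have hvn : v ^ n = V := by
    rw [hv, one_div, Real.rpow_inv_natCast_pow hV.le (by omega)]
  have hkn : k ^ n = κ := by
    rw [hk, one_div, Real.rpow_inv_natCast_pow hκ.le (by omega)]
  have hkp : κ ^ (((n : ℝ) - 1) / n) = k ^ (n - 1) := by
    rw [hk, ← Real.rpow_natCast, ← Real.rpow_mul hκ.le, Nat.cast_sub (by omega), Nat.cast_one]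
    congr 1
    ring
  have h := finrank_mul_volume_le_sum_norm hn hV (div_pos hv0 hk0)
    (by rw [div_pow, hvn, hkn, div_mul_cancel₀ _ hκ.ne'])
  rw [hkp]
  have hsplit : V = v ^ (n - 1) * v := by
    rw [← hvn, ← pow_succ, Nat.sub_add_cancel (by omega)]
  change n * V ≤ (v / k) ^ (n - 1) * κ' * S at h
  have hvp : 0 < v ^ (n - 1) := by positivity
  have hkp0 : 0 < k ^ (n - 1) := by positivity
  rw [div_pow] at h
  have h2 : v ^ (n - 1) / k ^ (n - 1) * κ' * (n * (k ^ (n - 1) / κ') * v) ≤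
      v ^ (n - 1) / k ^ (n - 1) * κ' * S := by
    refine le_trans (le_of_eq ?_) h
    rw [hsplit]
    field_simp
  exact le_of_mul_le_mul_left h2 (by positivity)

variable {E : Type*} [NormedAddCommGroup E] [InnerProductSpace ℝ E]
  [FiniteDimensional ℝ E] [MeasurableSpace E] [BorelSpace E]

/-- The surface area of the projection of `A` to the subspace `W`. -/
def projSurfaceArea (W : Submodule ℝ E) (A : Set E) : ℝ :=
  surfaceArea (W.orthogonalProjectionOnto '' A)

/-- A lower bound for the surface area of a zonotope by the surface areas of its projections. -/
theorem mul_sum_norm_le_surfaceArea (hd : 2 ≤ finrank ℝ E) {l : List E}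
    (hZ : IsCentredBody (zonotope l)) {m : ℝ}
    (hm : ∀ ξ : E, ‖ξ‖ = 1 → m ≤ surfaceArea (perpProj ξ '' zonotope l)) :
    m * (l.map fun a => ‖a‖).sum ≤ (finrank ℝ E - 1 : ℕ) * surfaceArea (zonotope l) := by
  have : Nontrivial E := nontrivial_of_finrank_pos (R := ℝ) (by omega)
  set Z := zonotope l with hZdef
  have key : ∀ η : ℝ, 1 < η →
      m * (l.map fun a => ‖a‖).sum ≤ (finrank ℝ E - 1 : ℕ) * (η * surfaceArea Z) := by
    intro η hη
    obtain ⟨c, hc⟩ := exists_isNearUnitBall (E := E) hη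
    have h1 : (l.map fun a => ‖a‖ * (c.map fun b => sweep (perpProj a '' Z) (perpProj a b)).sum).sum
        ≤ (finrank ℝ E - 1 : ℕ) * (c.map (sweep Z)).sum := by
      have hswap : (l.map fun a => ‖a‖ *
          (c.map fun b => sweep (perpProj a '' Z) (perpProj a b)).sum).sum =
          (c.map fun b => (l.map fun a => ‖a‖ * sweep (perpProj a '' Z) (perpProj a b)).sum).sum := by
        clear_value Z
        clear hZ hm hZdef
        induction l with
        | nil => simp
        | cons a l ih =>
          rw [List.map_cons, List.sum_cons, ih]
          simp only [List.map_cons, List.sum_cons, List.sum_map_add, List.sum_map_mul_left]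
      rw [hswap, ← List.sum_map_mul_left]
      exact List.sum_le_sum fun b _ => sum_sweep_projection_le l b
    have h2 : m * (l.map fun a => ‖a‖).sum ≤
        (l.map fun a => ‖a‖ * (c.map fun b => sweep (perpProj a '' Z) (perpProj a b)).sum).sum := by
      rw [← List.sum_map_mul_left]
      refine List.sum_le_sum fun a _ => ?_
      rcases eq_or_ne a 0 with rfl | ha
      · simp
      rw [mul_comm]
      refine mul_le_mul_of_nonneg_left ?_ (norm_nonneg a)
      have := nontrivial_perp hd ha
      have h3 := ((hc.map_perpProj a).surfaceArea_le (hZ.image_perpProj a)).1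
      rw [List.map_map] at h3
      refine le_trans ?_ h3
      have hna : ‖a‖⁻¹ ≠ 0 := inv_ne_zero (norm_ne_zero_iff.2 ha)
      have h4 := hm (‖a‖⁻¹ • a) (by
        rw [norm_smul, norm_inv, norm_norm, inv_mul_cancel₀ (norm_ne_zero_iff.2 ha)])
      -- Stated as a function of the subspace, the surface area can be rewritten along the equality
      -- of spans.
      change m ≤ projSurfaceArea (Submodule.span ℝ {‖a‖⁻¹ • a})ᗮ Z at h4
      rwa [Submodule.span_singleton_smul_eq hna.isUnit] at h4
    have h5 := mul_le_mul_of_nonneg_left (hc.surfaceArea_le hZ).2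
      (Nat.cast_nonneg (α := ℝ) (finrank ℝ E - 1))
    exact (h2.trans h1).trans h5
  have := le_of_forall_pos_le_continuous (f := fun η : ℝ =>
    ((finrank ℝ E - 1 : ℕ) : ℝ) * (η * surfaceArea Z)) (by fun_prop) key
  simpa using this

/-- The surface area of the projection to a hyperplane attains its minimum. -/
theorem IsCentredBody.exists_min_surfaceArea (hd : 2 ≤ finrank ℝ E) {A : Set E}
    (hA : IsCentredBody A) :
    ∃ ξ : E, ‖ξ‖ = 1 ∧ ∀ ζ : E, ‖ζ‖ = 1 →
      surfaceArea (perpProj ξ '' A) ≤ surfaceArea (perpProj ζ '' A) := by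
  have : Nontrivial E := nontrivial_of_finrank_pos (R := ℝ) (by omega)
  have hlsc : LowerSemicontinuousOn (fun ξ : E => surfaceArea (perpProj ξ '' A))
      (sphere (0 : E) 1) := by
    intro ξ hξ y hy
    obtain ⟨η, hη, hyη⟩ : ∃ η : ℝ, 1 < η ∧ η * y < surfaceArea (perpProj ξ '' A) := by
      have hcont : Continuous fun η : ℝ => η * y := by fun_prop
      have h : ∀ᶠ η in 𝓝[>] (1 : ℝ), η * y < surfaceArea (perpProj ξ '' A) :=
        (hcont.continuousAt.mono_left (nhdsWithin_le_nhds (s := Ioi (1 : ℝ)))).eventually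
          (gt_mem_nhds (by simpa using hy))
      obtain ⟨η, h1, h2⟩ := (h.and self_mem_nhdsWithin).exists
      exact ⟨η, h2, h1⟩
    obtain ⟨c, hc⟩ := exists_isNearUnitBall (E := E) hη
    -- The hyperplane varies with `ζ`, but by Cauchy's formula and the symmetry of the second
    -- difference, `G` approximates the projected surface area on the sphere within the factor `η`,
    -- and `G` is continuous on the fixed space `E`.
    set G : E → ℝ := fun ζ =>
      (c.map fun b => sweep (A + segment ℝ 0 b) ζ - sweep A ζ).sum with hG
    have hGc : Continuous G := by
      refine continuous_list_sum c fun b _ => ?_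
      exact (hA.add (isCompact_segment 0 b) (convex_segment 0 b)
        (left_mem_segment _ _ _)).continuous_sweep.sub hA.continuous_sweep
    have hGS : ∀ ζ ∈ sphere (0 : E) 1, surfaceArea (perpProj ζ '' A) ≤ G ζ ∧
        G ζ ≤ η * surfaceArea (perpProj ζ '' A) := by
      intro ζ hζ
      have hζ1 : ‖ζ‖ = 1 := by simpa using hζ
      have hζ0 : ζ ≠ 0 := by
        rintro rfl
        simp at hζ1
      have := nontrivial_perp hd hζ0
      have h := (hc.map_perpProj ζ).surfaceArea_le (hA.image_perpProj ζ)
      have e : G ζ = ((c.map (perpProj ζ)).map (sweep (perpProj ζ '' A))).sum := by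
        rw [hG, List.map_map]
        simp only
        congr 2
        ext b
        rw [Function.comp_apply]
        have h1 : sweep (A + segment ℝ 0 b) ζ - sweep A ζ =
            sweep (A + segment ℝ 0 ζ) b - sweep A b := by
          simp only [sweep, add_right_comm A]
          ring
        rw [h1, sweep_add_segment_sub hA.isCompact hA.convex, hζ1, one_mul]
      rw [e]
      exact h
    have hev : ∀ᶠ ζ in 𝓝[sphere (0 : E) 1] ξ, η * y < G ζ :=
      (hGc.continuousAt.mono_left nhdsWithin_le_nhds).eventually
        (lt_mem_nhds (hyη.trans_le (hGS ξ hξ).1))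
    filter_upwards [hev, self_mem_nhdsWithin] with ζ h1 h2
    exact lt_of_mul_lt_mul_left (h1.trans_le (hGS ζ h2).2) (by linarith)
  obtain ⟨ξ, hξ, hmin⟩ := hlsc.exists_isMinOn (NormedSpace.sphere_nonempty.2 zero_le_one)
    (isCompact_sphere 0 1)
  exact ⟨ξ, by simpa using hξ, fun ζ hζ => hmin (by simpa using hζ)⟩

theorem isCentredBody_of_symmetric {A : Set E} (hc : IsCompact A) (hA : Convex ℝ A)
    (hi : (interior A).Nonempty) (hs : ∀ x ∈ A, -x ∈ A) : IsCentredBody A := by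
  refine ⟨hc, hA, ?_⟩
  obtain ⟨x, hx⟩ := hi
  have h := hA.combo_interior_self_mem_interior hx (hs x (interior_subset hx))
    (a := 1 / 2) (b := 1 / 2) (by norm_num) (by norm_num) (by norm_num)
  rw [smul_neg, add_neg_cancel] at h
  exact mem_interior_iff_mem_nhds.1 h

/-- A projection body is nearly a zonotope. -/
theorem IsProjectionBody.exists_zonotope {n : ℕ} (hn : 2 ≤ n)
    {L : ConvexBody (EuclideanSpace ℝ (Fin n))} (hL : IsProjectionBody L) {r : ℝ} (hr : 1 < r) :
    ∃ l : List (EuclideanSpace ℝ (Fin n)),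
      (L : Set (EuclideanSpace ℝ (Fin n))) ⊆ zonotope l ∧
      zonotope l ⊆ r • (L : Set (EuclideanSpace ℝ (Fin n))) := by
  have : Nontrivial (EuclideanSpace ℝ (Fin n)) :=
    nontrivial_of_finrank_pos (R := ℝ) (by rw [finrank_euclideanSpace_fin]; omega)
  obtain ⟨hLi, K, ⟨x₀, hx₀⟩, hsymm, hsupp⟩ := hL
  have hr0 : 0 < r := by linarith
  -- `K` need not contain the origin; sweeps do not see the translation that centres it.
  set K' : Set (EuclideanSpace ℝ (Fin n)) := -x₀ +ᵥ (K : Set (EuclideanSpace ℝ (Fin n))) with hK'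
  have hK'B : IsCentredBody K' := by
    refine ⟨K.isCompact.vadd _, K.convex.vadd _, ?_⟩
    have := vadd_mem_nhds_vadd (-x₀) (mem_interior_iff_mem_nhds.1 hx₀)
    rwa [vadd_eq_add, neg_add_cancel] at this
  have hsup : ∀ x, (∀ y ∈ L, inner ℝ x y ≤ sweep K' x) ∧ ∃ y ∈ L, inner ℝ x y = sweep K' x := by
    intro x
    rw [hK', sweep_vadd]
    rcases eq_or_ne x 0 with rfl | hx
    · obtain ⟨y, hy⟩ := L.nonempty
      exact ⟨fun y _ => by simp [sweep_zero], y, hy, by simp [sweep_zero]⟩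
    set θ := ‖x‖⁻¹ • x with hθ
    have hx0 : 0 < ‖x‖ := norm_pos_iff.2 hx
    have hθ1 : ‖θ‖ = 1 := by rw [hθ, norm_smul, norm_inv, norm_norm, inv_mul_cancel₀ hx0.ne']
    have hxθ : x = ‖x‖ • θ := by rw [hθ, smul_smul, mul_inv_cancel₀ hx0.ne', one_smul]
    have hsw : sweep (K : Set (EuclideanSpace ℝ (Fin n))) x =
        ‖x‖ * supportFunction (L : Set (EuclideanSpace ℝ (Fin n))) θ := by
      conv_lhs => rw [hxθ]
      rw [sweep_smul_right K.isCompact K.convex hx0.le, sweep_eq K.isCompact K.convex, hθ1, one_mul,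
        hsupp θ hθ1]
      rfl
    have hcomp : IsCompact ((fun y => (inner ℝ θ y : ℝ)) '' (L : Set (EuclideanSpace ℝ (Fin n)))) :=
      L.isCompact.image (by fun_prop)
    have hin : ∀ y, (inner ℝ x y : ℝ) = ‖x‖ * inner ℝ θ y := by
      intro y
      conv_lhs => rw [hxθ, inner_smul_left]
      rfl
    rw [hsw]
    constructor
    · intro y hy
      rw [hin]
      exact mul_le_mul_of_nonneg_left (le_csSup hcomp.bddAbove ⟨y, hy, rfl⟩) hx0.le
    · obtain ⟨y, hy, h⟩ := hcomp.sSup_mem (L.nonempty.image _)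
      exact ⟨y, hy, by rw [hin]; exact congrArg _ h⟩
  obtain ⟨l, hl⟩ := hK'B.exists_zonotopeSupport hr
  refine ⟨l, ?_, ?_⟩
  · refine subset_of_forall_inner_le (convex_zonotope l) (isCompact_zonotope l) fun x y hy => ?_
    obtain ⟨z, hz, h⟩ := exists_mem_zonotope_inner_eq l x
    exact ⟨z, hz, h ▸ ((hsup x).1 y hy).trans (hl x).1⟩
  · refine subset_of_forall_inner_le (L.convex.smul r) (L.isCompact.smul r) fun x y hy => ?_
    obtain ⟨z, hz, h⟩ := (hsup x).2
    refine ⟨r • z, smul_mem_smul_set hz, ?_⟩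
    rw [inner_smul_right, h]
    exact (inner_le_zonotopeSupport x hy).trans (hl x).2

theorem ballConstant_nonneg (n : ℕ) : 0 ≤ ballConstant n :=
  div_nonneg (Real.rpow_nonneg (bodyVolume_unitBall_pos n).le _) (bodyVolume_unitBall_pos _).le

theorem IsProjectionBody.isCentredBody {n : ℕ} {L : ConvexBody (EuclideanSpace ℝ (Fin n))}
    (hL : IsProjectionBody L) : IsCentredBody (L : Set (EuclideanSpace ℝ (Fin n))) :=
  isCentredBody_of_symmetric L.isCompact L.convex hL.1 hL.2.choose_spec.2.1

theorem IsProjectionBody.le_surfaceArea {n : ℕ} (hn : 2 ≤ n)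
    {L : ConvexBody (EuclideanSpace ℝ (Fin n))} (hL : IsProjectionBody L) {m : ℝ} (hm0 : 0 ≤ m)
    (hm : ∀ ξ : EuclideanSpace ℝ (Fin n), ‖ξ‖ = 1 →
      m ≤ surfaceArea (perpProj ξ '' (L : Set (EuclideanSpace ℝ (Fin n))))) :
    (n : ℝ) / ((n : ℝ) - 1) * ballConstant n * m * bodyVolume L ^ (1 / (n : ℝ)) ≤
      surfaceArea (L : Set (EuclideanSpace ℝ (Fin n))) := by
  have hLB := hL.isCentredBody
  set A : Set (EuclideanSpace ℝ (Fin n)) := (L : Set (EuclideanSpace ℝ (Fin n)))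
  have hd : finrank ℝ (EuclideanSpace ℝ (Fin n)) = n := finrank_euclideanSpace_fin
  have hn1 : (0 : ℝ) < (n : ℝ) - 1 := by
    have : (2 : ℝ) ≤ n := by exact_mod_cast hn
    linarith
  have hcast : ((n - 1 : ℕ) : ℝ) = (n : ℝ) - 1 := by
    rw [Nat.cast_sub (by omega), Nat.cast_one]
  have hVpos : 0 < volume.real A :=
    ENNReal.toReal_pos (Measure.measure_pos_of_mem_nhds volume hLB.mem_nhds).ne'
      hLB.isCompact.measure_lt_top.ne
  have key : ∀ r : ℝ, 1 < r → m * (n * ballConstant n * volume.real A ^ (1 / (n : ℝ))) ≤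
      ((n : ℝ) - 1) * (r ^ (n - 1) * surfaceArea A) := by
    intro r hr
    have hr0 : (0 : ℝ) < r := by linarith
    obtain ⟨l, h1, h2⟩ := hL.exists_zonotope hn hr
    have hZ : IsCentredBody (zonotope l) :=
      ⟨isCompact_zonotope l, convex_zonotope l, mem_of_superset hLB.mem_nhds h1⟩
    have hVle : volume.real A ≤ volume.real (zonotope l) :=
      measureReal_mono h1 hZ.isCompact.measure_lt_top.ne
    have h3 := ballConstant_mul_volume_rpow_le_sum_norm hn (hVpos.trans_le hVle)
    have h4 := mul_sum_norm_le_surfaceArea (by omega) hZ (m := m) fun ξ hξ =>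
      (hm ξ hξ).trans
        ((hLB.image_perpProj ξ).surfaceArea_mono (hZ.image_perpProj ξ) (image_mono h1))
    have h5 := hZ.surfaceArea_mono (hLB.smul hr0) h2
    rw [surfaceArea_smul hr0, hd] at h5
    rw [hd, hcast] at h4
    have h6 : n * ballConstant n * volume.real A ^ (1 / (n : ℝ)) ≤
        n * ballConstant n * volume.real (zonotope l) ^ (1 / (n : ℝ)) :=
      mul_le_mul_of_nonneg_left (Real.rpow_le_rpow hVpos.le hVle (by positivity))
        (mul_nonneg (Nat.cast_nonneg n) (ballConstant_nonneg n))
    calc _ ≤ m * (l.map fun a => ‖a‖).sum := mul_le_mul_of_nonneg_left (h6.trans h3) hm0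
      _ ≤ _ := h4
      _ ≤ _ := mul_le_mul_of_nonneg_left h5 hn1.le
  have h := le_of_forall_pos_le_continuous (f := fun r : ℝ =>
    ((n : ℝ) - 1) * (r ^ (n - 1) * surfaceArea A)) (by fun_prop) key
  simp only [one_pow, one_mul] at h
  rw [show bodyVolume L = volume.real A from rfl]
  calc _ = m * (n * ballConstant n * volume.real A ^ (1 / (n : ℝ))) / ((n : ℝ) - 1) := by ring
    _ ≤ surfaceArea A := by
        rw [div_le_iff₀ hn1]
        linarith

theorem isProjectionBody_unitBall {n : ℕ} (hn : 2 ≤ n) : IsProjectionBody (unitBall n) := by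
  have hd : finrank ℝ (EuclideanSpace ℝ (Fin n)) = n := finrank_euclideanSpace_fin
  have : Nontrivial (EuclideanSpace ℝ (Fin n)) :=
    nontrivial_of_finrank_pos (R := ℝ) (by omega)
  have hint : ∀ r : ℝ, 0 < r → (interior (closedBall (0 : EuclideanSpace ℝ (Fin n)) r)).Nonempty :=
    fun r hr => ⟨0, mem_interior_iff_mem_nhds.2 (closedBall_mem_nhds 0 hr)⟩
  have hκ := bodyVolume_unitBall_pos (n - 1)
  set κ := bodyVolume (unitBall (n - 1)) with hκdef
  -- The radius whose ball has all hyperplane projections of volume 1, the support function of the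
  -- unit ball on the sphere.
  set r : ℝ := κ⁻¹ ^ (((n - 1 : ℕ) : ℝ)⁻¹) with hr
  have hr0 : 0 < r := Real.rpow_pos_of_pos (inv_pos.2 hκ) _
  have hrn : r ^ (n - 1) = κ⁻¹ := Real.rpow_inv_natCast_pow (inv_pos.2 hκ).le (by omega)
  refine ⟨hint 1 one_pos, ⟨closedBall 0 r, convex_closedBall 0 r, isCompact_closedBall 0 r,
    nonempty_closedBall.2 hr0.le⟩, hint r hr0, ?_, ?_⟩
  · intro x hx
    have hx' : x ∈ closedBall (0 : EuclideanSpace ℝ (Fin n)) 1 := hx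
    have : -x ∈ closedBall (0 : EuclideanSpace ℝ (Fin n)) 1 := by simpa using hx'
    exact this
  · intro θ hθ
    have hθ0 : θ ≠ 0 := by
      rintro rfl
      simp at hθ
    have h1 : supportFunction (closedBall (0 : EuclideanSpace ℝ (Fin n)) 1) θ = 1 := by
      refine IsGreatest.csSup_eq ⟨⟨θ, by simp [hθ], ?_⟩, ?_⟩
      · simp [hθ]
      · rintro _ ⟨y, hy, rfl⟩
        have hy : ‖y‖ ≤ 1 := by simpa using hy
        have := real_inner_le_norm θ y
        rw [hθ, one_mul] at this
        exact this.trans hy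
    have h2 : volume.real (perpProj θ '' closedBall (0 : EuclideanSpace ℝ (Fin n)) r) = 1 := by
      rw [perpProj_image_closedBall, ← smul_unitClosedBall_of_nonneg hr0.le,
        volume_real_smul hr0.le, volume_real_closedBall_one, finrank_perp hθ0, hd, hrn, ← hκdef,
        inv_mul_cancel₀ hκ.ne']
    exact h1.trans h2.symm

end ProjectionBody

end ConvexBodyInequality

theorem corollary2 (n : ℕ) (hn : 2 ≤ n) :
    (∀ L : ConvexBody (EuclideanSpace ℝ (Fin n)), IsProjectionBody L →
      ∃ m : ℝ, IsMinProjectionSurfaceArea L m ∧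
        (n : ℝ) / ((n : ℝ) - 1) * ballConstant n * m * bodyVolume L ^ (1 / (n : ℝ)) ≤
          surfaceArea (L : Set (EuclideanSpace ℝ (Fin n)))) ∧
    1 / Real.sqrt (Real.exp 1) < ballConstant n ∧
    IsProjectionBody (unitBall n) ∧
    (∃ m : ℝ, IsMinProjectionSurfaceArea (unitBall n) m ∧
      surfaceArea (unitBall n : Set (EuclideanSpace ℝ (Fin n))) =
        (n : ℝ) / ((n : ℝ) - 1) * ballConstant n * m *
          bodyVolume (unitBall n) ^ (1 / (n : ℝ))) := by
  have hd : Module.finrank ℝ (EuclideanSpace ℝ (Fin n)) = n := finrank_euclideanSpace_fin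
  have : Nontrivial (EuclideanSpace ℝ (Fin n)) :=
    Module.nontrivial_of_finrank_pos (R := ℝ) (by omega)
  refine ⟨fun L hL => ?_, inv_sqrt_exp_lt_ballConstant hn, isProjectionBody_unitBall hn, ?_⟩
  · obtain ⟨ξ, hξ, hmin⟩ := hL.isCentredBody.exists_min_surfaceArea (by omega)
    refine ⟨_, ⟨⟨ξ, hξ, rfl⟩, ?_⟩, hL.le_surfaceArea hn (surfaceArea_nonneg _) hmin⟩
    rintro _ ⟨ζ, hζ, rfl⟩
    exact hmin ζ hζ
  · have hS : ∀ ξ : EuclideanSpace ℝ (Fin n), ‖ξ‖ = 1 →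
        surfaceArea (hyperplaneProjection (unitBall n : Set (EuclideanSpace ℝ (Fin n))) ξ) =
          (n - 1 : ℕ) * bodyVolume (unitBall (n - 1)) := by
      intro ξ hξ
      have hξ0 : ξ ≠ 0 := by
        rintro rfl
        simp at hξ
      have := surfaceArea_perp_closedBall (by omega) hξ0
      rw [hd] at this
      exact this
    obtain ⟨ξ, hξ⟩ := exists_norm_eq (EuclideanSpace ℝ (Fin n)) zero_le_one
    refine ⟨_, ⟨⟨ξ, hξ, rfl⟩, ?_⟩, ?_⟩
    · rintro _ ⟨ζ, hζ, rfl⟩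
      rw [hS ξ hξ, hS ζ hζ]
    · have hB := surfaceArea_closedBall_one (E := EuclideanSpace ℝ (Fin n))
        fun η hη => exists_isNearUnitBall hη
      rw [hd] at hB
      have hκ := bodyVolume_unitBall_pos n
      have hκ' := bodyVolume_unitBall_pos (n - 1)
      have hn1 : (0 : ℝ) < (n : ℝ) - 1 := by
        have : (2 : ℝ) ≤ n := by exact_mod_cast hn
        linarith
      have hn0 : (n : ℝ) ≠ 0 := by positivity
      -- The minimum is `(n - 1) * |B_2^(n-1)|`, which cancels the denominators; the remaining two
      -- powers of `|B_2^n|` combine to `|B_2^n|`, and `S(B_2^n) = n * |B_2^n|`.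
      have hpow : bodyVolume (unitBall n) ^ (((n : ℝ) - 1) / n) *
          bodyVolume (unitBall n) ^ (1 / (n : ℝ)) = bodyVolume (unitBall n) := by
        rw [← Real.rpow_add hκ, ← add_div, sub_add_cancel, div_self hn0, Real.rpow_one]
      refine hB.trans ?_
      rw [hS ξ hξ, ballConstant, Nat.cast_sub (by omega), Nat.cast_one]
      conv_lhs => rw [← hpow]
      field_simp
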